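/- Let $\varphi$ be an Orlicz $N$-function (continuous, even, convex, $\varphi(0)=0$, $\varphi(x)>0$ for $x\ne0$, $\varphi(x)/x\to0$ as $x\to0$, $\varphi(x)/x\to\infty$ as $x\to\infty$) with $\liminf_{x\to0}\varphi(x)/x^2>0$, and let $\varphi^*(x)=\sup_{y\in\mathbb R}(xy-\varphi(y))$. A random variable $\zeta$ is $\varphi$-sub-Gaussian if $\mathsf E\zeta=0$ and $\mathsf Ee^{\lambda\zeta}\le e^{\varphi(a\lambda)}$ for some $a>0$ and all $\lambda\in\mathbb R$; $\tau_\varphi(\zeta)$ is the infimum of such $a$. A family $\Delta$ of $\varphi$-sub-Gaussian variables is strictly $\varphi$-sub-Gaussian with determining constant $C_\Delta\ge 0$ if $\tau_\varphi(\zeta)\le C_\Delta(\mathsf E\zeta^2)^{1/2}$ for all linear combinations $\zeta$ of elements of $\Delta$. Let $Z$ be an admissible function for $\varphi$ with constant $u_0\ge0$: $Z$ is continuous and strictly increasing on $[0,\infty)$, positive on $(0,\infty)$, unbounded, $u/Z(u)$ is non-decreasing for $u>u_0$, and $\int_0^\varepsilon\Psi\big(\ln(Z^{(-1)}(1/s)-u_0)\big)\,ds<\infty$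 for some $\varepsilon>0$, where $\Psi(v)=v/\varphi^{(-1)}(v)$ and $\varphi^{(-1)}$ is the inverse of $\varphi$ on $[0,\infty)$. Let $y=\{y(u),u\in\mathbb R\}$ be a real strictly $\varphi$-sub-Gaussian process with determining constant $C_y$ whose covariance function $\Gamma_y(s,t)=\mathsf Ey(s)y(t)$ has finite (Vitali) variation on $\mathbb R^2$. Let $\kappa=\cos$ or $\kappa=\sin$, let $a_1,\dots,a_N\in\mathbb R$, and let $a\le b$, $c\le d$ with $\varkappa=\max(b-a,d-c)>0$. Assume that for $a\le t\le b$, $c\le x\le d$ the mean-square integrals $$U(t,x)=\int_{-\infty}^{\infty}\kappa\Big(\lambda x+t\sum_{k=1}^Na_k\lambda^{2k+1}(-1)^k\Big)\,dy(\lambda)$$ exist and that $U$ is continuous on $[a,b]\times[c,d]$ with probability one. (Formally, $U$ is the solution of $\sum_{k=1}^Na_k\,\partial^{2k+1}U/\partial x^{2k+1}=\partial U/\partial t$ with the harmonizable initial condition $U(0,x)=\int\kappa(\lambda x)\,dy(\lambda)$.) Put $w(\lambda)=Z\big(\tfrac{|\lambda|}2+u_0\big)+Z\big(\tfrac12\big|\sum_{k=1}^Na_k\lambda^{2k+1}(-1)^k\big|+u_0\big)$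 and assume that $$C_Z^2=\int_{-\infty}^\infty\int_{-\infty}^\infty w(\lambda)w(\mu)\,d|\Gamma_y(\lambda,\mu)|<\infty .$$ Put $\sigma(h)=2C_yC_Z/Z(1/h+u_0)$ for $0<h\le\varkappa$, $\gamma_0=\sigma(\varkappa)$ and $\varepsilon_0=\sup_{a\le t\le b,\,c\le x\le d}\tau_\varphi(U(t,x))$. Let $r:[1,\infty)\to[0,\infty)$ be strictly increasing, with $x\mapsto r(e^x)$ convex on $[0,\infty)$, and assume that for $0<\varepsilon\le\gamma_0$ $$\int_0^\varepsilon r\Big(\Big(\frac{b-a}{2\sigma^{(-1)}(v)}+1\Big)\Big(\frac{d-c}{2\sigma^{(-1)}(v)}+1\Big)\Big)dv<\infty .$$ For $0\le\delta\le\gamma_0$ let $$\hat I_r(\delta)=\int_0^\delta r\Big(\Big(\tfrac{b-a}2\big(Z^{(-1)}\big(\tfrac{2C_ZC_y}s\big)-u_0\big)+1\Big)\Big(\tfrac{d-c}2\big(Z^{(-1)}\big(\tfrac{2C_ZC_y}s\big)-u_0\big)+1\Big)\Big)ds .$$ Then for all $0<\theta<1$ and $u>0$ $$\mathsf P\Big\{\sup_{a\le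 t\le b,\ c\le x\le d}|U(t,x)|>u\Big\}\le 2\exp\Big\{-\varphi^*\Big(\frac{u(1-\theta)}{\varepsilon_0}\Big)\Big\}\;r^{(-1)}\Big(\frac{\hat I_r(\min(\theta\varepsilon_0,\gamma_0))+r(1)\max(\theta\varepsilon_0-\gamma_0,0)}{\theta\varepsilon_0}\Big),$$ where $r^{(-1)}$ is the inverse of $r$ (if $\varepsilon_0=0$, the probability is $0$). The term with $r(1)$ vanishes if $r(1)=0$ (for example $r(v)=\ln v$ or $r(v)=v^\beta-1$, $\beta>0$) or if $\theta\varepsilon_0\le\gamma_0$. -/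

import Mathlib

open MeasureTheory ProbabilityTheory Set Filter Topology
open scoped ENNReal

noncomputable section

namespace PhiSub

/-- An Orlicz `N`-function that satisfies condition `Q`, that is,
`liminf φ x / x ^ 2 > 0` as `x → 0` (the value `∞` being allowed). -/
structure IsNFunctionQ (φ : ℝ → ℝ) : Prop where
  continuous : Continuous φ
  even : ∀ x, φ (-x) = φ x
  convex : ConvexOn ℝ univ φ
  zero : φ 0 = 0
  pos : ∀ x, x ≠ 0 → 0 < φ x
  tendsto_zero : Tendsto (fun x => φ x / x) (𝓝[≠] 0) (𝓝 0)
  tendsto_top : Tendsto (fun x => φ x / x) atTop atTop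
  condQ : ∃ c : ℝ, 0 < c ∧ ∀ᶠ x in 𝓝[≠] 0, c ≤ φ x / x ^ 2

/-- The Young--Fenchel transform (convex conjugate) of `φ`. -/
def conj (φ : ℝ → ℝ) (x : ℝ) : ℝ := ⨆ y : ℝ, (x * y - φ y)

/-- The function `Ψ v = v / φ⁻¹ v`, with `φ⁻¹` the inverse of `φ` on `[0, ∞)`. -/
def Psi (φ : ℝ → ℝ) (v : ℝ) : ℝ := v / Function.invFunOn φ (Ici 0) v

/-- The inverse of a function `Z` given on `[0, ∞)`. -/
def invZ (Z : ℝ → ℝ) (v : ℝ) : ℝ := Function.invFunOn Z (Ici 0) v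

/-- The inverse of a function `r` given on `[1, ∞)`. -/
def invR (r : ℝ → ℝ) (v : ℝ) : ℝ := Function.invFunOn r (Ici 1) v

/-- `Z` (a function on `[0, ∞)`), with the constant `u₀`, is admissible for the space
`Sub_φ`. Divergence of `Z` at infinity is what makes `Z⁻¹ (1 / s)` meaningful for all small
`s > 0`. -/
structure IsAdmissible (φ Z : ℝ → ℝ) (u₀ : ℝ) : Prop where
  u₀_nonneg : 0 ≤ u₀
  continuousOn : ContinuousOn Z (Ici 0)
  strictMonoOn : StrictMonoOn Z (Ici 0)
  pos : ∀ u, 0 < u → 0 < Z u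
  ratio_mono : MonotoneOn (fun u => u / Z u) (Ioi u₀)
  tendsto_top : Tendsto Z atTop atTop
  integral_lt_top : ∃ ε : ℝ, 0 < ε ∧
    IntegrableOn (fun s => Psi φ (Real.log (invZ Z (1 / s) - u₀))) (Ioc 0 ε)

variable {Ω : Type*} [MeasurableSpace Ω]

/-- The random variable `ζ` is `φ`-sub-Gaussian. -/
structure IsPhiSubGaussian (φ : ℝ → ℝ) (μ : Measure Ω) (ζ : Ω → ℝ) : Prop where
  integrable : Integrable ζ μ
  mean_zero : ∫ ω, ζ ω ∂μ = 0
  integrable_exp : ∀ l : ℝ, Integrable (fun ω => Real.exp (l * ζ ω)) μ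
  bound : ∃ a : ℝ, 0 < a ∧ ∀ l : ℝ, ∫ ω, Real.exp (l * ζ ω) ∂μ ≤ Real.exp (φ (l * a))

/-- The `φ`-sub-Gaussian standard of a random variable. -/
def tau (φ : ℝ → ℝ) (μ : Measure Ω) (ζ : Ω → ℝ) : ℝ :=
  sInf {a : ℝ | 0 < a ∧ ∀ l : ℝ, Integrable (fun ω => Real.exp (l * ζ ω)) μ ∧
    ∫ ω, Real.exp (l * ζ ω) ∂μ ≤ Real.exp (φ (a * l))}

/-- The family `y` is strictly `φ`-sub-Gaussian with determining constant `C`. Only finite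
linear combinations are required to satisfy the inequality; it passes to mean-square convergent
series by taking limits. -/
structure IsStrictlyPhiSubGaussian {T : Type*} (φ : ℝ → ℝ) (μ : Measure Ω) (y : T → Ω → ℝ)
    (C : ℝ) : Prop where
  nonneg : 0 ≤ C
  mem : ∀ i, IsPhiSubGaussian φ μ (y i)
  le : ∀ (s : Finset T) (c : T → ℝ),
    tau φ μ (fun ω => ∑ i ∈ s, c i * y i ω) ≤
      C * Real.sqrt (∫ ω, (∑ i ∈ s, c i * y i ω) ^ 2 ∂μ)

/-- The covariance function `Γ_y (s, t) = E y(s) y(t)` of a centered process. -/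
def covFun (μ : Measure Ω) (y : ℝ → Ω → ℝ) (s t : ℝ) : ℝ := ∫ ω, y s ω * y t ω ∂μ

/-- A tagged partition `A = pt 0 ≤ pt 1 ≤ … ≤ pt n = B` of `[A, B]`, with
`tag i ∈ [pt i, pt (i + 1)]`. -/
structure TaggedGrid (A B : ℝ) where
  n : ℕ
  pt : ℕ → ℝ
  tag : ℕ → ℝ
  mono : Monotone pt
  first : pt 0 = A
  last : pt n = B
  tag_mem : ∀ i, i < n → tag i ∈ Icc (pt i) (pt (i + 1))

/-- All cells of the partition have length at most `δ`. -/
def TaggedGrid.MeshLE {A B : ℝ} (P : TaggedGrid A B) (δ : ℝ) : Prop :=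
  ∀ i, i < P.n → P.pt (i + 1) - P.pt i ≤ δ

/-- The Riemann--Stieltjes sum of `f` against the increments of `y`. -/
def TaggedGrid.sum {A B : ℝ} (P : TaggedGrid A B) (f : ℝ → ℝ) (y : ℝ → Ω → ℝ) (ω : Ω) : ℝ :=
  ∑ i ∈ Finset.range P.n, f (P.tag i) * (y (P.pt (i + 1)) ω - y (P.pt i) ω)

/-- `J` is the mean-square integral `∫_A^B f(λ) dy(λ)`: the Riemann--Stieltjes sums converge to
`J` in `L²` as the mesh tends to zero. -/
def IsMSIntegralOn (μ : Measure Ω) (f : ℝ → ℝ) (y : ℝ → Ω → ℝ) (A B : ℝ) (J : Ω → ℝ) : Prop :=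
  MemLp J 2 μ ∧ ∀ ε : ℝ, 0 < ε → ∃ δ : ℝ, 0 < δ ∧ ∀ P : TaggedGrid A B, P.MeshLE δ →
    eLpNorm (fun ω => P.sum f y ω - J ω) 2 μ ≤ ENNReal.ofReal ε

/-- `X` is the mean-square integral `∫_{-∞}^{∞} f(λ) dy(λ)`: the `L²`-limit of the mean-square
integrals over `[A, B]` as `A → -∞`, `B → ∞`. -/
def IsMSIntegral (μ : Measure Ω) (f : ℝ → ℝ) (y : ℝ → Ω → ℝ) (X : Ω → ℝ) : Prop :=
  MemLp X 2 μ ∧ ∃ J : ℝ → ℝ → Ω → ℝ,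
    (∀ A B, A < B → IsMSIntegralOn μ f y A B (J A B)) ∧
    Tendsto (fun p : ℝ × ℝ => eLpNorm (fun ω => J p.1 p.2 ω - X ω) 2 μ)
      (atBot ×ˢ atTop) (𝓝 0)

/-- The increment of `G` over the rectangle `(s, s'] × (t, t']`. -/
def rectIncr (G : ℝ → ℝ → ℝ) (s s' t t' : ℝ) : ℝ := G s' t' - G s t' - G s' t + G s t

/-- The integral `∫∫ f(s, t) |dG(s, t)|` of a nonnegative continuous function against the
absolute variation of `G`: the limit, as the grids are refined and exhaust the plane, of
`∑ ∑ f(s, t) |Δ_i Δ_j G|`. It is written as the supremum of the lower sums, which increase under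
refinement. -/
def varIntegral (G : ℝ → ℝ → ℝ) (f : ℝ → ℝ → ℝ≥0∞) : ℝ≥0∞ :=
  ⨆ (n : ℕ) (m : ℕ) (p : ℕ → ℝ) (q : ℕ → ℝ) (_ : Monotone p) (_ : Monotone q),
    ∑ i ∈ Finset.range n, ∑ j ∈ Finset.range m,
      (⨅ s ∈ Icc (p i) (p (i + 1)), ⨅ t ∈ Icc (q j) (q (j + 1)), f s t) *
        ENNReal.ofReal |rectIncr G (p i) (p (i + 1)) (q j) (q (j + 1))|

/-- `G` has finite (Vitali) variation on the plane. -/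
def HasFiniteVitaliVariation (G : ℝ → ℝ → ℝ) : Prop := varIntegral G (fun _ _ => 1) < ∞

/-- The dispersion symbol `∑_{k=1}^N a_k λ^{2k+1} (-1)^k`. -/
def symb (N : ℕ) (a : ℕ → ℝ) (l : ℝ) : ℝ :=
  ∑ k ∈ Finset.Icc 1 N, a k * l ^ (2 * k + 1) * (-1) ^ k

/-- The kernel `I(t, x, λ) = κ(λ x + t ∑_{k=1}^N a_k λ^{2k+1} (-1)^k)`. -/
def kernelI (κ : ℝ → ℝ) (N : ℕ) (a : ℕ → ℝ) (t x l : ℝ) : ℝ := κ (l * x + t * symb N a l)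

/-- The factor `Z(|λ|/2 + u₀) + Z(|∑ a_k λ^{2k+1} (-1)^k|/2 + u₀)`. -/
def weight (Z : ℝ → ℝ) (u₀ : ℝ) (N : ℕ) (a : ℕ → ℝ) (l : ℝ) : ℝ :=
  Z (|l| / 2 + u₀) + Z (1 / 2 * |symb N a l| + u₀)

/-- The integral that defines `C_Z ^ 2`, with values in `[0, ∞]`. -/
def CZsq (G : ℝ → ℝ → ℝ) (Z : ℝ → ℝ) (u₀ : ℝ) (N : ℕ) (a : ℕ → ℝ) : ℝ≥0∞ :=
  varIntegral G (fun l m => ENNReal.ofReal (weight Z u₀ N a l * weight Z u₀ N a m))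

/-- The constant `C_Z`. -/
def CZ (G : ℝ → ℝ → ℝ) (Z : ℝ → ℝ) (u₀ : ℝ) (N : ℕ) (a : ℕ → ℝ) : ℝ :=
  Real.sqrt (CZsq G Z u₀ N a).toReal

/-- `σ(h) = 2 C / Z(1/h + u₀)`, where `C = C_y C_Z`. -/
def sigma (Z : ℝ → ℝ) (u₀ C : ℝ) (h : ℝ) : ℝ := 2 * C / Z (1 / h + u₀)

/-- The inverse of `σ` on `(0, H]`. -/
def invSigma (σ : ℝ → ℝ) (H v : ℝ) : ℝ := Function.invFunOn σ (Ioc 0 H) v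

/-- The integrand of the entropy integral `Ĩ_r` on a rectangle with sides `L₁`, `L₂`. -/
def entropyIntegrand (r σ : ℝ → ℝ) (L₁ L₂ v : ℝ) : ℝ :=
  r ((L₁ / (2 * invSigma σ (max L₁ L₂) v) + 1) * (L₂ / (2 * invSigma σ (max L₁ L₂) v) + 1))

/-- The integral `Î_r(δ)` on a rectangle with sides `L₁`, `L₂`, where `C = C_y C_Z`. -/
def hatI (r Z : ℝ → ℝ) (u₀ C L₁ L₂ δ : ℝ) : ℝ :=
  ∫ s in (0 : ℝ)..δ, r ((L₁ / 2 * (invZ Z (2 * C / s) - u₀) + 1) *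
    (L₂ / 2 * (invZ Z (2 * C / s) - u₀) + 1))

/-- `ε₀ = sup τ_φ(U(t, x))` over the rectangle `[a, b] × [c, d]`. -/
def eps0 (φ : ℝ → ℝ) (μ : Measure Ω) (U : ℝ → ℝ → Ω → ℝ) (a b c d : ℝ) : ℝ :=
  sSup ((fun p : ℝ × ℝ => tau φ μ (U p.1 p.2)) '' (Icc a b ×ˢ Icc c d))

end PhiSub

end

/-! ### Exponential moment bounds for `φ`-sub-Gaussian variables. -/

namespace PhiSub

variable {Ω : Type*} [MeasurableSpace Ω] {μ : Measure Ω} {φ : ℝ → ℝ}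

/-! The estimate is a chaining argument in which Hölder's inequality plays the role of the union
bound.

Increments come first. Riemann–Stieltjes sums lie in the linear span of `y`, so strictness bounds
their exponential moments in terms of their `L²` norm, and Fatou's lemma carries this to mean-square
integrals (`IsMSIntegral.expBound`). The second moment of such a sum is a double sum against
rectangle increments of the covariance. If `|f| ≤ M w` and the tags minimize `w` on the cells, it is
at most `M²` times a lower sum of the weighted variation (`IsMSIntegral.eLpNorm_le`). For
differences of the kernel over a distance `h`, admissibility of `Z` gives `M = 2 / Z(1/h + u₀)`, so
these increments have standard at most `σ(h)` (`expBound_increment`). A grid of covering radius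
`σ⁻¹(v)` is then a `v`-net; for `v > γ₀` a single point suffices, which is where the term with `r 1`
comes from (`exists_net_field`).

Chaining through nets at the scales `θ^(k+1) ε₀` gives links of standard `θ^k ε₀`. With Hölder
weights `(1-θ) θ^k` the ratio of standard to weight does not depend on `k`. Every layer therefore
contributes the same `φ(l ε₀ / (1-θ))`, and the net sizes enter only through a weighted geometric
mean (`measure_layers_le`, `measure_finite_sup_le`). Jensen's inequality for the convex function `r
∘ exp` compares that mean with the entropy integral (`prod_rpow_le_invR`). Optimizing over `l`
produces `φ*` (`le_exp_neg_conj`), and sample continuity passes from finite sets to the supremum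
(`measure_iSup_le`). -/

theorem IsNFunctionQ.mono_abs (hφ : IsNFunctionQ φ) {x y : ℝ} (h : |x| ≤ |y|) : φ x ≤ φ y := by
  have hy : φ |y| = φ y := by
    rcases abs_choice y with h | h <;> rw [h]
    exact hφ.even y
  -- On `[-|y|, |y|]` a convex function is at most the larger endpoint value, and evenness makes the
  -- two equal.
  have := hφ.convex.le_max_of_mem_Icc (mem_univ (-|y|)) (mem_univ |y|) (abs_le.1 h)
  rwa [hφ.even, max_self, hy] at this

theorem IsNFunctionQ.nonneg (hφ : IsNFunctionQ φ) (x : ℝ) : 0 ≤ φ x := by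
  have := hφ.mono_abs (x := 0) (y := x) (by simp)
  rwa [hφ.zero] at this

/-- The exponential moments of `ζ` are bounded by `exp (φ (a * l))`. -/
structure ExpBound (φ : ℝ → ℝ) (μ : Measure Ω) (ζ : Ω → ℝ) (a : ℝ) : Prop where
  aemeasurable : AEMeasurable ζ μ
  le : ∀ l : ℝ, ∫⁻ ω, ENNReal.ofReal (Real.exp (l * ζ ω)) ∂μ ≤ ENNReal.ofReal (Real.exp (φ (a * l)))

theorem ExpBound.mono {ζ : Ω → ℝ} {a b : ℝ} (hφ : IsNFunctionQ φ) (h : ExpBound φ μ ζ a)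
    (ha : 0 ≤ a) (hab : a ≤ b) : ExpBound φ μ ζ b := by
  refine ⟨h.aemeasurable, fun l => (h.le l).trans ?_⟩
  gcongr
  refine hφ.mono_abs ?_
  rw [abs_mul, abs_mul, abs_of_nonneg ha, abs_of_nonneg (ha.trans hab)]
  gcongr

theorem ExpBound.congr {ζ ξ : Ω → ℝ} {a : ℝ} (h : ExpBound φ μ ζ a) (e : ζ =ᵐ[μ] ξ) :
    ExpBound φ μ ξ a := by
  refine ⟨h.aemeasurable.congr e, fun l => le_trans (le_of_eq ?_) (h.le l)⟩
  refine lintegral_congr_ae ?_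
  filter_upwards [e] with ω hω
  rw [hω]

theorem ExpBound.aemeasurable_exp {ζ : Ω → ℝ} {a : ℝ} (h : ExpBound φ μ ζ a) (l : ℝ) :
    AEMeasurable (fun ω => ENNReal.ofReal (Real.exp (l * ζ ω))) μ :=
  (Real.measurable_exp.comp_aemeasurable (h.aemeasurable.const_mul l)).ennreal_ofReal

theorem ExpBound.integrable {ζ : Ω → ℝ} {a : ℝ} (h : ExpBound φ μ ζ a) (l : ℝ) :
    Integrable (fun ω => Real.exp (l * ζ ω)) μ := by
  refine ⟨(Real.measurable_exp.comp_aemeasurable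
    (h.aemeasurable.const_mul l)).aestronglyMeasurable, ?_⟩
  rw [hasFiniteIntegral_iff_ofReal (ae_of_all _ fun ω => (Real.exp_pos _).le)]
  exact (h.le l).trans_lt ENNReal.ofReal_lt_top

/-- Bridges the form used in `tau` and the Lebesgue-integral form, in which Hölder and Fatou need no
integrability side conditions. -/
theorem expBound_iff {ζ : Ω → ℝ} {a : ℝ} : ExpBound φ μ ζ a ↔ AEMeasurable ζ μ ∧
    ∀ l : ℝ, Integrable (fun ω => Real.exp (l * ζ ω)) μ ∧
      ∫ ω, Real.exp (l * ζ ω) ∂μ ≤ Real.exp (φ (a * l)) := by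
  refine ⟨fun h => ⟨h.aemeasurable, fun l => ⟨h.integrable l, ?_⟩⟩, fun h => ⟨h.1, fun l => ?_⟩⟩
  · have := h.le l
    rwa [← ofReal_integral_eq_lintegral_ofReal (h.integrable l)
      (ae_of_all _ fun ω => (Real.exp_pos _).le),
      ENNReal.ofReal_le_ofReal_iff (Real.exp_pos _).le] at this
  · rw [← ofReal_integral_eq_lintegral_ofReal (h.2 l).1
      (ae_of_all _ fun ω => (Real.exp_pos _).le)]
    exact ENNReal.ofReal_le_ofReal (h.2 l).2

theorem tau_nonneg (ζ : Ω → ℝ) : 0 ≤ tau φ μ ζ := Real.sInf_nonneg fun _ h => h.1.le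

theorem ExpBound.tau_le {ζ : Ω → ℝ} {a : ℝ} (hφ : IsNFunctionQ φ) (h : ExpBound φ μ ζ a)
    (ha : 0 ≤ a) : tau φ μ ζ ≤ a := by
  refine le_of_forall_gt_imp_ge_of_dense fun b hb => ?_
  exact csInf_le ⟨0, fun _ h => h.1.le⟩
    ⟨ha.trans_lt hb, (expBound_iff.1 (h.mono hφ ha hb.le)).2⟩

/-- The infimum is attained because `φ` is continuous. The given bound makes the set of constants
nonempty; without it `sInf ∅ = 0` would carry no information. -/
theorem ExpBound.tau {ζ : Ω → ℝ} {a : ℝ} (hφ : IsNFunctionQ φ) (h : ExpBound φ μ ζ a)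
    (ha : 0 < a) : ExpBound φ μ ζ (tau φ μ ζ) := by
  refine ⟨h.aemeasurable, fun l => ?_⟩
  obtain ⟨s, -, hs, hmem⟩ := exists_seq_tendsto_sInf (S := {a : ℝ | 0 < a ∧ ∀ l : ℝ,
    Integrable (fun ω => Real.exp (l * ζ ω)) μ ∧
    ∫ ω, Real.exp (l * ζ ω) ∂μ ≤ Real.exp (φ (a * l))}) ⟨a, ha, (expBound_iff.1 h).2⟩
    ⟨0, fun _ h => h.1.le⟩
  have hc : Continuous fun x : ℝ => ENNReal.ofReal (Real.exp (φ (x * l))) :=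
    ENNReal.continuous_ofReal.comp (Real.continuous_exp.comp
      (hφ.continuous.comp (continuous_id.mul continuous_const)))
  refine ge_of_tendsto' ((hc.tendsto _).comp hs) fun n => ?_
  exact (expBound_iff.2 ⟨h.aemeasurable, (hmem n).2⟩).le l

theorem expBound_zero [IsProbabilityMeasure μ] (hφ : IsNFunctionQ φ) (a : ℝ) :
    ExpBound φ μ (fun _ => 0) a := by
  refine ⟨aemeasurable_const, fun l => ?_⟩
  simpa using hφ.nonneg (a * l)

theorem ExpBound.const_mul {ζ : Ω → ℝ} {a : ℝ} (h : ExpBound φ μ ζ a) (c : ℝ) :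
    ExpBound φ μ (fun ω => c * ζ ω) (a * c) := by
  refine ⟨h.aemeasurable.const_mul c, fun l => ?_⟩
  have := h.le (l * c)
  rw [show a * c * l = a * (l * c) by ring]
  simpa only [mul_assoc] using this

/-- Hölder with weights proportional to `a` and `b`: rescaling `l` by each weight turns both bounds
into `φ((a + b) l)`. -/
theorem ExpBound.add {ζ ξ : Ω → ℝ} {a b : ℝ} (hζ : ExpBound φ μ ζ a) (hξ : ExpBound φ μ ξ b)
    (ha : 0 < a) (hb : 0 < b) : ExpBound φ μ (fun ω => ζ ω + ξ ω) (a + b) := by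
  refine ⟨hζ.aemeasurable.add hξ.aemeasurable, fun l => ?_⟩
  have hab : 0 < a + b := by positivity
  set p := a / (a + b) with hp
  set q := b / (a + b) with hq
  have hp0 : 0 < p := by positivity
  have hq0 : 0 < q := by positivity
  have hpq : p + q = 1 := by rw [hp, hq]; field_simp
  have key := ENNReal.lintegral_mul_norm_pow_le (hζ.aemeasurable_exp (l / p))
    (hξ.aemeasurable_exp (l / q)) hp0.le hq0.le hpq
  have e1 : ∀ ω, ENNReal.ofReal (Real.exp (l * (ζ ω + ξ ω))) =
      ENNReal.ofReal (Real.exp (l / p * ζ ω)) ^ p * ENNReal.ofReal (Real.exp (l / q * ξ ω)) ^ q := by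
    intro ω
    rw [ENNReal.ofReal_rpow_of_pos (Real.exp_pos _), ENNReal.ofReal_rpow_of_pos (Real.exp_pos _),
      ← ENNReal.ofReal_mul (by positivity), ← Real.exp_mul, ← Real.exp_mul, ← Real.exp_add]
    congr 2
    field_simp
  simp_rw [e1]
  refine key.trans ?_
  have h1 := ENNReal.rpow_le_rpow (hζ.le (l / p)) hp0.le
  have h2 := ENNReal.rpow_le_rpow (hξ.le (l / q)) hq0.le
  refine (mul_le_mul' h1 h2).trans (le_of_eq ?_)
  rw [ENNReal.ofReal_rpow_of_pos (Real.exp_pos _), ENNReal.ofReal_rpow_of_pos (Real.exp_pos _),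
      ← ENNReal.ofReal_mul (by positivity), ← Real.exp_mul, ← Real.exp_mul, ← Real.exp_add]
  have ea : a * (l / p) = (a + b) * l := by rw [hp]; field_simp
  have eb : b * (l / q) = (a + b) * l := by rw [hq]; field_simp
  rw [ea, eb, ← mul_add, hpq, mul_one]

theorem IsPhiSubGaussian.expBound {ζ : Ω → ℝ} (h : IsPhiSubGaussian φ μ ζ) :
    ∃ a : ℝ, 0 < a ∧ ExpBound φ μ ζ a := by
  obtain ⟨a, ha, hb⟩ := h.bound
  refine ⟨a, ha, expBound_iff.2 ⟨h.integrable.aemeasurable, fun l => ⟨h.integrable_exp l, ?_⟩⟩⟩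
  rw [mul_comm a]
  exact hb l

theorem IsPhiSubGaussian.memLp_two {ζ : Ω → ℝ} (h : IsPhiSubGaussian φ μ ζ) : MemLp ζ 2 μ := by
  have : integrableExpSet ζ μ = univ := by
    ext l
    simpa [integrableExpSet] using h.integrable_exp l
  exact_mod_cast memLp_of_mem_interior_integrableExpSet (X := ζ) (μ := μ) (by simp [this]) 2

theorem exists_expBound_of_mem_span [IsProbabilityMeasure μ] (hφ : IsNFunctionQ φ) {T : Type*}
    {y : T → Ω → ℝ} (hy : ∀ i, IsPhiSubGaussian φ μ (y i)) {ζ : Ω → ℝ}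
    (hζ : ζ ∈ Submodule.span ℝ (range y)) : ∃ a : ℝ, 0 < a ∧ ExpBound φ μ ζ a := by
  induction hζ using Submodule.span_induction with
  | mem x hx =>
    obtain ⟨i, rfl⟩ := hx
    exact (hy i).expBound
  | zero => exact ⟨1, one_pos, expBound_zero hφ 1⟩
  | add x z _ _ hx hz =>
    obtain ⟨a, ha, hx⟩ := hx
    obtain ⟨b, hb, hz⟩ := hz
    exact ⟨a + b, by positivity, hx.add hz ha hb⟩
  | smul c x _ hx =>
    obtain ⟨a, ha, hx⟩ := hx
    -- The extra `1` keeps the constant positive when `c = 0`.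
    refine ⟨a * (|c| + 1), by positivity, hx.aemeasurable.const_mul c, fun l => ?_⟩
    refine ((hx.const_mul c).le l).trans ?_
    gcongr
    refine hφ.mono_abs ?_
    rw [abs_mul, abs_mul, abs_mul, abs_mul]
    rw [abs_of_nonneg (by positivity : (0 : ℝ) ≤ |c| + 1)]
    gcongr
    linarith

theorem sqrt_integral_sq {ζ : Ω → ℝ} (h : MemLp ζ 2 μ) :
    Real.sqrt (∫ ω, ζ ω ^ 2 ∂μ) = (eLpNorm ζ 2 μ).toReal := by
  rw [h.eLpNorm_eq_integral_rpow_norm two_ne_zero ENNReal.ofNat_ne_top,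
    ENNReal.toReal_ofReal (by positivity), Real.sqrt_eq_rpow]
  simp

theorem memLp_two_of_mem_span {T : Type*} {y : T → Ω → ℝ}
    (hy : ∀ i, MemLp (y i) 2 μ) {ζ : Ω → ℝ}
    (hζ : ζ ∈ Submodule.span ℝ (range y)) : MemLp ζ 2 μ := by
  induction hζ using Submodule.span_induction with
  | mem x hx =>
    obtain ⟨i, rfl⟩ := hx
    exact hy i
  | zero => exact MemLp.zero'
  | add x z _ _ hx hz => exact hx.add hz
  | smul c x _ hx => exact hx.const_smul c

/-- Strictness only controls `tau`, which is also `0` when no constant exists. The a priori bound on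
the span turns it into a genuine exponential estimate. -/
theorem IsStrictlyPhiSubGaussian.expBound_of_mem_span [IsProbabilityMeasure μ]
    (hφ : IsNFunctionQ φ) {T : Type*} {y : T → Ω → ℝ} {C : ℝ}
    (hy : IsStrictlyPhiSubGaussian φ μ y C) {ζ : Ω → ℝ}
    (hζ : ζ ∈ Submodule.span ℝ (range y)) : ExpBound φ μ ζ (C * (eLpNorm ζ 2 μ).toReal) := by
  obtain ⟨a, ha, h⟩ := exists_expBound_of_mem_span hφ hy.mem hζ
  have hL := memLp_two_of_mem_span (fun i => (hy.mem i).memLp_two) hζ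
  refine (h.tau hφ ha).mono hφ (tau_nonneg ζ) ?_
  rw [← sqrt_integral_sq hL]
  obtain ⟨c, rfl⟩ := Finsupp.mem_span_range_iff_exists_finsupp.1 hζ
  have := hy.le c.support c
  have e : (c.sum fun i a => a • y i) = fun ω => ∑ i ∈ c.support, c i * y i ω := by
    ext ω
    simp [Finsupp.sum]
  rwa [e]

/-- The exponential bound of a strictly sub-Gaussian family passes to mean-square limits. -/
theorem expBound_of_approx (hφ : IsNFunctionQ φ) {C : ℝ} {ζ : Ω → ℝ} (hζ : MemLp ζ 2 μ)
    (h : ∀ ε : ℝ, 0 < ε → ∃ ξ : Ω → ℝ, MemLp ξ 2 μ ∧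
      ExpBound φ μ ξ (C * (eLpNorm ξ 2 μ).toReal) ∧
      eLpNorm (fun ω => ξ ω - ζ ω) 2 μ ≤ ENNReal.ofReal ε) :
    ExpBound φ μ ζ (C * (eLpNorm ζ 2 μ).toReal) := by
  choose! ξ hξm hξb hξe using h
  obtain ⟨ε, -, hε0, hε⟩ := exists_seq_strictAnti_tendsto (0 : ℝ)
  have hlim : Tendsto (fun n => eLpNorm (ξ (ε n) - ζ) 2 μ) atTop (𝓝 0) := by
    have h0 : Tendsto (fun n => ENNReal.ofReal (ε n)) atTop (𝓝 0) := by
      rw [← ENNReal.ofReal_zero]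
      exact (ENNReal.continuous_ofReal.tendsto 0).comp hε
    exact tendsto_of_tendsto_of_tendsto_of_le_of_le tendsto_const_nhds h0 (fun _ => zero_le)
      fun n => hξe _ (hε0 n)
  have hnorm : Tendsto (fun n => (eLpNorm (ξ (ε n)) 2 μ).toReal) atTop
      (𝓝 (eLpNorm ζ 2 μ).toReal) := by
    rw [tendsto_iff_dist_tendsto_zero]
    refine squeeze_zero (fun _ => dist_nonneg) (fun n => ?_)
      ((ENNReal.tendsto_toReal ENNReal.zero_ne_top).comp hlim)
    have hm := hξm _ (hε0 n)
    rw [Real.dist_eq, abs_le]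
    have fin : eLpNorm (ξ (ε n) - ζ) 2 μ ≠ ∞ := (hm.sub hζ).eLpNorm_ne_top
    have h1 : (eLpNorm (ξ (ε n)) 2 μ).toReal ≤ (eLpNorm (ξ (ε n) - ζ) 2 μ).toReal +
        (eLpNorm ζ 2 μ).toReal := by
      rw [← ENNReal.toReal_add fin hζ.eLpNorm_ne_top]
      refine ENNReal.toReal_mono (ENNReal.add_ne_top.2 ⟨fin, hζ.eLpNorm_ne_top⟩) ?_
      simpa using eLpNorm_add_le (hm.sub hζ).1 hζ.1 (p := 2) (by norm_num)
    have h2 : (eLpNorm ζ 2 μ).toReal ≤ (eLpNorm (ξ (ε n)) 2 μ).toReal +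
        (eLpNorm (ξ (ε n) - ζ) 2 μ).toReal := by
      rw [← ENNReal.toReal_add hm.eLpNorm_ne_top fin]
      refine ENNReal.toReal_mono (ENNReal.add_ne_top.2 ⟨hm.eLpNorm_ne_top, fin⟩) ?_
      simpa using eLpNorm_sub_le hm.1 (hm.sub hζ).1 (p := 2) (by norm_num)
    simp only [Function.comp]
    constructor <;> linarith
  -- `L²` convergence gives an almost surely convergent subsequence, to which Fatou's lemma applies.
  obtain ⟨ns, hns, hae⟩ := (tendstoInMeasure_of_tendsto_eLpNorm two_ne_zero
    (fun n => (hξm _ (hε0 n)).1) hζ.1 hlim).exists_seq_tendsto_ae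
  refine ⟨hζ.1.aemeasurable, fun l => ?_⟩
  have hc : Continuous fun x : ℝ => ENNReal.ofReal (Real.exp (l * x)) :=
    ENNReal.continuous_ofReal.comp (by fun_prop)
  have hc' : Continuous fun x : ℝ => ENNReal.ofReal (Real.exp (φ (C * x * l))) :=
    ENNReal.continuous_ofReal.comp (Real.continuous_exp.comp
      (hφ.continuous.comp (by fun_prop)))
  calc ∫⁻ ω, ENNReal.ofReal (Real.exp (l * ζ ω)) ∂μ
      = ∫⁻ ω, liminf (fun n => ENNReal.ofReal (Real.exp (l * ξ (ε (ns n)) ω))) atTop ∂μ := by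
        refine lintegral_congr_ae ?_
        filter_upwards [hae] with ω hω
        exact (((hc.tendsto _).comp hω).liminf_eq).symm
    _ ≤ liminf (fun n => ∫⁻ ω, ENNReal.ofReal (Real.exp (l * ξ (ε (ns n)) ω)) ∂μ) atTop :=
        lintegral_liminf_le' fun n => (hξb _ (hε0 (ns n))).aemeasurable_exp l
    _ ≤ liminf (fun n => ENNReal.ofReal
          (Real.exp (φ (C * (eLpNorm (ξ (ε (ns n))) 2 μ).toReal * l)))) atTop :=
        liminf_le_liminf (Eventually.of_forall fun n => (hξb _ (hε0 (ns n))).le l)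
    _ = _ := ((hc'.tendsto _).comp (hnorm.comp hns.tendsto_atTop)).liminf_eq

end PhiSub

/-! ### Mean-square Stieltjes integrals and their second moments. -/

namespace PhiSub

section

variable {Ω : Type*}

theorem TaggedGrid.sum_sub {A B : ℝ} (P : TaggedGrid A B) (f g : ℝ → ℝ) (y : ℝ → Ω → ℝ) (ω : Ω) :
    P.sum (fun l => f l - g l) y ω = P.sum f y ω - P.sum g y ω := by
  simp only [TaggedGrid.sum, ← Finset.sum_sub_distrib, sub_mul]

theorem TaggedGrid.sum_mem_span {A B : ℝ} (P : TaggedGrid A B) (f : ℝ → ℝ) (y : ℝ → Ω → ℝ) :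
    P.sum f y ∈ Submodule.span ℝ (range y) := by
  have : P.sum f y = ∑ i ∈ Finset.range P.n, f (P.tag i) • (y (P.pt (i + 1)) - y (P.pt i)) := by
    ext ω
    simp [TaggedGrid.sum]
  rw [this]
  exact Submodule.sum_mem _ fun i _ => Submodule.smul_mem _ _ (Submodule.sub_mem _
    (Submodule.subset_span (mem_range_self _)) (Submodule.subset_span (mem_range_self _)))

end

variable {Ω : Type*} [MeasurableSpace Ω] {μ : Measure Ω} {φ : ℝ → ℝ}

/-- Every interval has arbitrarily fine tagged partitions whose tags minimize a given continuous
function over the cells. -/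
theorem TaggedGrid.exists_argmin {A B δ : ℝ} (hAB : A < B) (hδ : 0 < δ) {w : ℝ → ℝ}
    (hw : Continuous w) : ∃ P : TaggedGrid A B, P.MeshLE δ ∧
      ∀ i, ∀ s ∈ Icc (P.pt i) (P.pt (i + 1)), w (P.tag i) ≤ w s := by
  obtain ⟨n, hn⟩ := exists_nat_gt ((B - A) / δ)
  have hn0 : (0 : ℝ) < n := lt_trans (div_pos (sub_pos.2 hAB) hδ) hn
  have hstep : 0 ≤ (B - A) / n := div_nonneg (sub_pos.2 hAB).le hn0.le
  set pt : ℕ → ℝ := fun i => A + i * ((B - A) / n) with hpt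
  have hmono : Monotone pt := fun i j hij => by
    have : (i : ℝ) ≤ j := by exact_mod_cast hij
    simp only [hpt]
    gcongr
  have hex : ∀ i, ∃ t ∈ Icc (pt i) (pt (i + 1)), ∀ s ∈ Icc (pt i) (pt (i + 1)), w t ≤ w s :=
    fun i => isCompact_Icc.exists_isMinOn (nonempty_Icc.2 (hmono i.le_succ)) hw.continuousOn
  choose tag htag hmin using hex
  refine ⟨⟨n, pt, tag, hmono, by simp [hpt], ?_, fun i _ => htag i⟩, fun i _ => ?_, hmin⟩
  · simp only [hpt]
    field_simp
    ring
  · simp only [hpt]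
    push_cast
    rw [div_lt_iff₀ hδ] at hn
    have : (B - A) / n ≤ δ := by
      rw [div_le_iff₀ hn0]
      linarith
    linarith

theorem IsMSIntegralOn.sub {f g : ℝ → ℝ} {y : ℝ → Ω → ℝ} {A B : ℝ} {X Y : Ω → ℝ}
    (hy : ∀ i, MemLp (y i) 2 μ) (hX : IsMSIntegralOn μ f y A B X)
    (hY : IsMSIntegralOn μ g y A B Y) :
    IsMSIntegralOn μ (fun l => f l - g l) y A B (fun ω => X ω - Y ω) := by
  refine ⟨hX.1.sub hY.1, fun ε hε => ?_⟩
  obtain ⟨δ₁, h1, H1⟩ := hX.2 (ε / 2) (by positivity)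
  obtain ⟨δ₂, h2, H2⟩ := hY.2 (ε / 2) (by positivity)
  refine ⟨min δ₁ δ₂, lt_min h1 h2, fun P hP => ?_⟩
  have a1 := H1 P fun i hi => (hP i hi).trans (min_le_left _ _)
  have a2 := H2 P fun i hi => (hP i hi).trans (min_le_right _ _)
  have m (f : ℝ → ℝ) : MemLp (P.sum f y) 2 μ := memLp_two_of_mem_span hy (P.sum_mem_span f y)
  calc eLpNorm (fun ω => P.sum (fun l => f l - g l) y ω - (X ω - Y ω)) 2 μ
      = eLpNorm ((fun ω => P.sum f y ω - X ω) - (fun ω => P.sum g y ω - Y ω)) 2 μ := by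
        congr 1
        ext ω
        simp only [TaggedGrid.sum_sub, Pi.sub_apply]
        ring
    _ ≤ _ := eLpNorm_sub_le ((m f).sub hX.1).1 ((m g).sub hY.1).1 (by norm_num)
    _ ≤ ENNReal.ofReal (ε / 2) + ENNReal.ofReal (ε / 2) := add_le_add a1 a2
    _ = ENNReal.ofReal ε := by rw [← ENNReal.ofReal_add (by positivity) (by positivity), add_halves]

theorem IsMSIntegral.sub {f g : ℝ → ℝ} {y : ℝ → Ω → ℝ} {X Y : Ω → ℝ}
    (hy : ∀ i, MemLp (y i) 2 μ) (hX : IsMSIntegral μ f y X) (hY : IsMSIntegral μ g y Y) :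
    IsMSIntegral μ (fun l => f l - g l) y (fun ω => X ω - Y ω) := by
  obtain ⟨hXm, J, hJ, hJl⟩ := hX
  obtain ⟨hYm, K, hK, hKl⟩ := hY
  refine ⟨hXm.sub hYm, fun A B ω => J A B ω - K A B ω, fun A B h => (hJ A B h).sub hy (hK A B h), ?_⟩
  have hsum := hJl.add hKl
  rw [add_zero] at hsum
  refine tendsto_of_tendsto_of_tendsto_of_le_of_le' tendsto_const_nhds hsum
    (Eventually.of_forall fun _ => zero_le) ?_
  have hev : ∀ᶠ p : ℝ × ℝ in atBot ×ˢ atTop, p.1 < p.2 := by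
    filter_upwards [(eventually_lt_atBot (0 : ℝ)).prod_mk (eventually_gt_atTop (0 : ℝ))] with p hp
    exact hp.1.trans hp.2
  filter_upwards [hev] with p hp
  calc eLpNorm (fun ω => J p.1 p.2 ω - K p.1 p.2 ω - (X ω - Y ω)) 2 μ
      = eLpNorm ((fun ω => J p.1 p.2 ω - X ω) - (fun ω => K p.1 p.2 ω - Y ω)) 2 μ := by
        congr 1
        ext ω
        simp only [Pi.sub_apply]
        ring
    _ ≤ _ := eLpNorm_sub_le ((hJ _ _ hp).1.sub hXm).1 ((hK _ _ hp).1.sub hYm).1 (by norm_num)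

/-- Convergence holds for every choice of tags once the mesh is small, so the tags may be taken at
minimizers of `w`; weighted sums then become lower sums. -/
theorem IsMSIntegral.exists_grid {f w : ℝ → ℝ} {y : ℝ → Ω → ℝ} {X : Ω → ℝ}
    (hy : ∀ i, MemLp (y i) 2 μ) (hX : IsMSIntegral μ f y X) (hw : Continuous w) {ε : ℝ}
    (hε : 0 < ε) : ∃ (A B : ℝ) (P : TaggedGrid A B),
      (∀ i, ∀ s ∈ Icc (P.pt i) (P.pt (i + 1)), w (P.tag i) ≤ w s) ∧
      eLpNorm (fun ω => P.sum f y ω - X ω) 2 μ ≤ ENNReal.ofReal ε := by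
  obtain ⟨hXm, J, hJ, hJl⟩ := hX
  have hev : ∀ᶠ p : ℝ × ℝ in atBot ×ˢ atTop, p.1 < p.2 := by
    filter_upwards [(eventually_lt_atBot (0 : ℝ)).prod_mk (eventually_gt_atTop (0 : ℝ))] with p hp
    exact hp.1.trans hp.2
  have hlt := hJl.eventually_lt_const (u := ENNReal.ofReal (ε / 2)) (by simpa using hε)
  obtain ⟨p, hp, hlt⟩ := (hev.and hlt).exists
  obtain ⟨δ, hδ, H⟩ := (hJ p.1 p.2 hp).2 (ε / 2) (by positivity)
  obtain ⟨P, hmesh, hmin⟩ := TaggedGrid.exists_argmin hp hδ hw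
  refine ⟨p.1, p.2, P, hmin, ?_⟩
  have m : MemLp (P.sum f y) 2 μ := memLp_two_of_mem_span hy (P.sum_mem_span f y)
  have hJm := (hJ p.1 p.2 hp).1
  calc eLpNorm (fun ω => P.sum f y ω - X ω) 2 μ
      = eLpNorm ((fun ω => P.sum f y ω - J p.1 p.2 ω) + (fun ω => J p.1 p.2 ω - X ω)) 2 μ := by
        congr 1
        ext ω
        simp
    _ ≤ _ := eLpNorm_add_le (m.sub hJm).1 (hJm.sub hXm).1 (by norm_num)
    _ ≤ ENNReal.ofReal (ε / 2) + ENNReal.ofReal (ε / 2) := add_le_add (H P hmesh) hlt.le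
    _ = ENNReal.ofReal ε := by rw [← ENNReal.ofReal_add (by positivity) (by positivity), add_halves]

theorem IsMSIntegral.expBound [IsProbabilityMeasure μ] (hφ : IsNFunctionQ φ) {f : ℝ → ℝ}
    {y : ℝ → Ω → ℝ} {C : ℝ} {X : Ω → ℝ} (hy : IsStrictlyPhiSubGaussian φ μ y C)
    (hX : IsMSIntegral μ f y X) : ExpBound φ μ X (C * (eLpNorm X 2 μ).toReal) := by
  have hy2 := fun i => (hy.mem i).memLp_two
  refine expBound_of_approx hφ hX.1 fun ε hε => ?_
  -- Only approximation matters here, so a constant `w` imposes no condition on the tags.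
  obtain ⟨A, B, P, -, hP⟩ := hX.exists_grid hy2 (w := fun _ => 0) continuous_const hε
  exact ⟨P.sum f y, memLp_two_of_mem_span hy2 (P.sum_mem_span f y),
    hy.expBound_of_mem_span hφ (P.sum_mem_span f y), hP⟩

theorem TaggedGrid.integral_sum_sq {A B : ℝ} (P : TaggedGrid A B) (f : ℝ → ℝ) {y : ℝ → Ω → ℝ}
    (hy : ∀ i, MemLp (y i) 2 μ) :
    ∫ ω, P.sum f y ω ^ 2 ∂μ = ∑ i ∈ Finset.range P.n, ∑ j ∈ Finset.range P.n,
      f (P.tag i) * f (P.tag j) *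
        rectIncr (covFun μ y) (P.pt i) (P.pt (i + 1)) (P.pt j) (P.pt (j + 1)) := by
  have hint (s t : ℝ) : Integrable (fun ω => y s ω * y t ω) μ := (hy s).integrable_mul (hy t)
  have hd (i : ℕ) : MemLp (fun ω => y (P.pt (i + 1)) ω - y (P.pt i) ω) 2 μ := (hy _).sub (hy _)
  have hrect (s s' t t' : ℝ) : ∫ ω, (y s' ω - y s ω) * (y t' ω - y t ω) ∂μ =
      rectIncr (covFun μ y) s s' t t' := by
    have : ∀ ω, (y s' ω - y s ω) * (y t' ω - y t ω) =
        y s' ω * y t' ω - y s ω * y t' ω - y s' ω * y t ω + y s ω * y t ω := fun ω => by ring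
    simp_rw [this]
    have h1 : Integrable (fun ω => y s' ω * y t' ω - y s ω * y t' ω) μ := (hint _ _).sub (hint _ _)
    have h2 : Integrable (fun ω => y s' ω * y t' ω - y s ω * y t' ω - y s' ω * y t ω) μ :=
      h1.sub (hint _ _)
    rw [integral_add h2 (hint _ _), integral_sub h1 (hint _ _), integral_sub (hint _ _) (hint _ _)]
    rfl
  have hexp : ∀ ω, P.sum f y ω ^ 2 = ∑ i ∈ Finset.range P.n, ∑ j ∈ Finset.range P.n,
      f (P.tag i) * f (P.tag j) * ((y (P.pt (i + 1)) ω - y (P.pt i) ω) *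
        (y (P.pt (j + 1)) ω - y (P.pt j) ω)) := by
    intro ω
    rw [sq, TaggedGrid.sum, Finset.sum_mul_sum]
    refine Finset.sum_congr rfl fun i _ => Finset.sum_congr rfl fun j _ => by ring
  have hi (i j : ℕ) : Integrable (fun ω => f (P.tag i) * f (P.tag j) *
      ((y (P.pt (i + 1)) ω - y (P.pt i) ω) * (y (P.pt (j + 1)) ω - y (P.pt j) ω))) μ :=
    ((hd i).integrable_mul (hd j)).const_mul _
  simp_rw [hexp]
  rw [integral_finsetSum _ fun i _ => integrable_finsetSum _ fun j _ => hi i j]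
  refine Finset.sum_congr rfl fun i _ => ?_
  rw [integral_finsetSum _ fun j _ => hi i j]
  refine Finset.sum_congr rfl fun j _ => ?_
  rw [integral_const_mul, hrect]

/-- At minimizing tags, `w(tag i) w(tag j)` is a lower bound for `w s * w t` on the cell since `w ≥
0`, so the sum is below a lower sum in the defining supremum. -/
theorem TaggedGrid.sum_le_varIntegral {A B : ℝ} (P : TaggedGrid A B) (G : ℝ → ℝ → ℝ)
    {w : ℝ → ℝ} (hw0 : ∀ s, 0 ≤ w s)
    (hP : ∀ i, ∀ s ∈ Icc (P.pt i) (P.pt (i + 1)), w (P.tag i) ≤ w s) :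
    ENNReal.ofReal (∑ i ∈ Finset.range P.n, ∑ j ∈ Finset.range P.n, w (P.tag i) * w (P.tag j) *
        |rectIncr G (P.pt i) (P.pt (i + 1)) (P.pt j) (P.pt (j + 1))|) ≤
      varIntegral G (fun s t => ENNReal.ofReal (w s * w t)) := by
  rw [ENNReal.ofReal_sum_of_nonneg fun i _ => Finset.sum_nonneg fun j _ =>
    mul_nonneg (mul_nonneg (hw0 _) (hw0 _)) (abs_nonneg _)]
  refine le_trans ?_ (le_iSup_of_le P.n <| le_iSup_of_le P.n <| le_iSup_of_le P.pt <|
    le_iSup_of_le P.pt <| le_iSup_of_le P.mono <| le_iSup_of_le P.mono le_rfl)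
  refine Finset.sum_le_sum fun i _ => ?_
  rw [ENNReal.ofReal_sum_of_nonneg fun j _ =>
    mul_nonneg (mul_nonneg (hw0 _) (hw0 _)) (abs_nonneg _)]
  refine Finset.sum_le_sum fun j _ => ?_
  rw [ENNReal.ofReal_mul (mul_nonneg (hw0 _) (hw0 _))]
  gcongr
  refine le_iInf₂ fun s hs => le_iInf₂ fun t ht => ?_
  exact ENNReal.ofReal_le_ofReal (mul_le_mul (hP i s hs) (hP j t ht) (hw0 _) (hw0 _))

/-- The mean-square bound for an integral whose integrand is dominated by a multiple of `w`. -/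
theorem IsMSIntegral.eLpNorm_le {f w : ℝ → ℝ} {y : ℝ → Ω → ℝ} {X : Ω → ℝ} {M : ℝ}
    (hy : ∀ i, MemLp (y i) 2 μ) (hX : IsMSIntegral μ f y X) (hw : Continuous w)
    (hw0 : ∀ s, 0 ≤ w s) (hM : 0 ≤ M) (hf : ∀ s, |f s| ≤ M * w s)
    (hfin : varIntegral (covFun μ y) (fun s t => ENNReal.ofReal (w s * w t)) < ∞) :
    (eLpNorm X 2 μ).toReal ≤
      M * √(varIntegral (covFun μ y) (fun s t => ENNReal.ofReal (w s * w t))).toReal := by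
  refine le_of_forall_pos_le_add fun ε hε => ?_
  obtain ⟨A, B, P, hmin, hP⟩ := hX.exists_grid hy hw hε
  have hm : MemLp (P.sum f y) 2 μ := memLp_two_of_mem_span hy (P.sum_mem_span f y)
  have h1 : (eLpNorm (P.sum f y) 2 μ).toReal ≤
      M * √(varIntegral (covFun μ y) (fun s t => ENNReal.ofReal (w s * w t))).toReal := by
    rw [← sqrt_integral_sq hm, ← Real.sqrt_sq hM, ← Real.sqrt_mul (sq_nonneg M)]
    refine Real.sqrt_le_sqrt ?_
    rw [P.integral_sum_sq f hy]
    have h2 := (ENNReal.ofReal_le_iff_le_toReal hfin.ne).1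
      (P.sum_le_varIntegral (covFun μ y) hw0 hmin)
    refine le_trans ?_ (mul_le_mul_of_nonneg_left h2 (sq_nonneg M))
    rw [Finset.mul_sum]
    refine Finset.sum_le_sum fun i _ => ?_
    rw [Finset.mul_sum]
    refine Finset.sum_le_sum fun j _ => ?_
    refine (le_abs_self _).trans ?_
    rw [abs_mul, abs_mul]
    calc _ ≤ (M * w (P.tag i)) * (M * w (P.tag j)) *
          |rectIncr (covFun μ y) (P.pt i) (P.pt (i + 1)) (P.pt j) (P.pt (j + 1))| := by
          gcongr
          · exact mul_nonneg hM (hw0 _)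
          · exact hf _
          · exact hf _
      _ = _ := by ring
  have fin : eLpNorm (fun ω => P.sum f y ω - X ω) 2 μ ≠ ∞ := (hm.sub hX.1).eLpNorm_ne_top
  have h3 : (eLpNorm X 2 μ).toReal ≤ (eLpNorm (P.sum f y) 2 μ).toReal +
      (eLpNorm (fun ω => P.sum f y ω - X ω) 2 μ).toReal := by
    rw [← ENNReal.toReal_add hm.eLpNorm_ne_top fin]
    refine ENNReal.toReal_mono (ENNReal.add_ne_top.2 ⟨hm.eLpNorm_ne_top, fin⟩) ?_
    calc eLpNorm X 2 μ = eLpNorm (P.sum f y - (P.sum f y - X)) 2 μ := by simp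
      _ ≤ _ := eLpNorm_sub_le hm.1 (hm.sub hX.1).1 (by norm_num)
  have h4 : (eLpNorm (fun ω => P.sum f y ω - X ω) 2 μ).toReal ≤ ε :=
    ENNReal.toReal_le_of_le_ofReal hε.le hP
  linarith

/-! ### Admissible functions and increments of the kernel. -/

variable {Z : ℝ → ℝ} {u₀ : ℝ}

theorem IsAdmissible.nonneg (hZ : IsAdmissible φ Z u₀) {u : ℝ} (hu : 0 ≤ u) : 0 ≤ Z u := by
  have h : Tendsto Z (𝓝[>] 0) (𝓝 (Z 0)) :=
    ((hZ.continuousOn 0 self_mem_Ici).mono Ioi_subset_Ici_self)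
  have h0 : 0 ≤ Z 0 := ge_of_tendsto h (by
    filter_upwards [self_mem_nhdsWithin] with x hx using (hZ.pos x hx).le)
  exact h0.trans (hZ.strictMonoOn.monotoneOn self_mem_Ici hu hu)

theorem IsAdmissible.continuous_weight (hZ : IsAdmissible φ Z u₀) (N : ℕ) (a : ℕ → ℝ) :
    Continuous (weight Z u₀ N a) := by
  have hs : Continuous (symb N a) := by
    unfold symb
    fun_prop
  have := hZ.u₀_nonneg
  refine Continuous.add (hZ.continuousOn.comp_continuous (by fun_prop) fun l => ?_)
    (hZ.continuousOn.comp_continuous (by fun_prop) fun l => ?_)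
  · exact add_nonneg (by positivity) this
  · exact add_nonneg (by positivity) this

theorem IsAdmissible.weight_nonneg (hZ : IsAdmissible φ Z u₀) (N : ℕ) (a : ℕ → ℝ) (l : ℝ) :
    0 ≤ weight Z u₀ N a l := by
  have := hZ.u₀_nonneg
  exact add_nonneg (hZ.nonneg (by positivity)) (hZ.nonneg (by positivity))

/-- If `|l|/2 ≥ 1/h`, the right side is at least `1`. Otherwise the sine is at most `(|l|/2)/(1/h) <
1`; adding `u₀` to numerator and denominator only increases this fraction, and monotonicity of `u /
Z u` bounds the result by the ratio of values of `Z`. -/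
theorem IsAdmissible.abs_sin_le (hZ : IsAdmissible φ Z u₀) {h l s : ℝ} (hh : 0 < h) (hs : |s| ≤ h) :
    |Real.sin (l * s / 2)| ≤ Z (|l| / 2 + u₀) / Z (1 / h + u₀) := by
  have hu := hZ.u₀_nonneg
  have hpos : 0 < Z (1 / h + u₀) := hZ.pos _ (by positivity)
  rcases le_or_gt (1 / h) (|l| / 2) with hl | hl
  · refine (Real.abs_sin_le_one _).trans ((one_le_div hpos).2 ?_)
    exact hZ.strictMonoOn.monotoneOn (mem_Ici.2 (by positivity)) (mem_Ici.2 (by positivity))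
      (by linarith)
  -- At `l = 0` the argument is `u₀` itself, outside the open ray on which `u / Z u` is monotone.
  · rcases eq_or_ne l 0 with rfl | hl0
    · simpa using div_nonneg (hZ.nonneg hu) hpos.le
    have hl0 : 0 < |l| / 2 := by positivity
    have hpos' : 0 < Z (|l| / 2 + u₀) := hZ.pos _ (by positivity)
    have hr : (|l| / 2 + u₀) / Z (|l| / 2 + u₀) ≤ (1 / h + u₀) / Z (1 / h + u₀) :=
      hZ.ratio_mono (mem_Ioi.2 (by linarith)) (mem_Ioi.2 (by linarith [hl0.trans hl]))
        (by linarith)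
    have h1 : |Real.sin (l * s / 2)| ≤ (|l| / 2) / (1 / h) := by
      refine (Real.abs_sin_le_abs).trans ?_
      rw [abs_div, abs_mul, abs_two, div_div_eq_mul_div, div_one]
      nlinarith [abs_nonneg l]
    have hh' : 0 < 1 / h := by positivity
    have h2 : (|l| / 2) / (1 / h) ≤ (|l| / 2 + u₀) / (1 / h + u₀) := by
      rw [div_le_div_iff₀ hh' (by positivity)]
      nlinarith
    refine h1.trans (h2.trans ?_)
    rw [div_le_div_iff₀ hpos' hpos] at hr
    rw [div_le_div_iff₀ (by positivity) hpos]
    linarith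

theorem abs_kappa_sub_le {κ : ℝ → ℝ} (hκ : κ = Real.cos ∨ κ = Real.sin) (x y : ℝ) :
    |κ x - κ y| ≤ 2 * |Real.sin ((x - y) / 2)| := by
  rcases hκ with rfl | rfl
  · rw [Real.cos_sub_cos, abs_mul, abs_mul]
    have := Real.abs_sin_le_one ((x + y) / 2)
    simp only [abs_neg, abs_two]
    nlinarith [abs_nonneg (Real.sin ((x - y) / 2))]
  · rw [Real.sin_sub_sin, abs_mul, abs_mul]
    have := Real.abs_cos_le_one ((x + y) / 2)
    simp only [abs_two]
    nlinarith [abs_nonneg (Real.sin ((x - y) / 2))]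

theorem abs_sin_add_le (x y : ℝ) : |Real.sin (x + y)| ≤ |Real.sin x| + |Real.sin y| := by
  rw [Real.sin_add]
  refine (abs_add_le _ _).trans ?_
  rw [abs_mul, abs_mul]
  nlinarith [Real.abs_cos_le_one x, Real.abs_cos_le_one y, abs_nonneg (Real.sin x),
    abs_nonneg (Real.sin y)]

theorem IsAdmissible.abs_kernelI_sub_le (hZ : IsAdmissible φ Z u₀) {κ : ℝ → ℝ}
    (hκ : κ = Real.cos ∨ κ = Real.sin) (N : ℕ) (a : ℕ → ℝ) {t t' x x' h : ℝ} (hh : 0 < h)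
    (ht : |t - t'| ≤ h) (hx : |x - x'| ≤ h) (l : ℝ) :
    |kernelI κ N a t x l - kernelI κ N a t' x' l| ≤
      2 / Z (1 / h + u₀) * weight Z u₀ N a l := by
  refine (abs_kappa_sub_le hκ _ _).trans ?_
  have e : (l * x + t * symb N a l - (l * x' + t' * symb N a l)) / 2 =
      l * (x - x') / 2 + symb N a l * (t - t') / 2 := by ring
  rw [e, weight]
  have h1 := hZ.abs_sin_le (l := l) hh hx
  have h2 := hZ.abs_sin_le (l := symb N a l) hh ht
  have h3 := abs_sin_add_le (l * (x - x') / 2) (symb N a l * (t - t') / 2)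
  rw [show 1 / 2 * |symb N a l| = |symb N a l| / 2 by ring]
  calc _ ≤ 2 * (Z (|l| / 2 + u₀) / Z (1 / h + u₀) +
        Z (|symb N a l| / 2 + u₀) / Z (1 / h + u₀)) := by linarith
    _ = _ := by ring

/-- The increments of the field are `φ`-sub-Gaussian with standard at most `σ h`. -/
theorem expBound_increment [IsProbabilityMeasure μ] (hφ : IsNFunctionQ φ)
    (hZ : IsAdmissible φ Z u₀) {y : ℝ → Ω → ℝ} {C : ℝ} (hy : IsStrictlyPhiSubGaussian φ μ y C)
    {κ : ℝ → ℝ} (hκ : κ = Real.cos ∨ κ = Real.sin) {N : ℕ} {a : ℕ → ℝ}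
    (hfin : CZsq (covFun μ y) Z u₀ N a < ∞) {t t' x x' h : ℝ} {X X' : Ω → ℝ} (hh : 0 < h)
    (ht : |t - t'| ≤ h) (hx : |x - x'| ≤ h) (hX : IsMSIntegral μ (kernelI κ N a t x) y X)
    (hX' : IsMSIntegral μ (kernelI κ N a t' x') y X') :
    ExpBound φ μ (fun ω => X ω - X' ω) (sigma Z u₀ (C * CZ (covFun μ y) Z u₀ N a) h) := by
  have hy2 := fun i => (hy.mem i).memLp_two
  have hu := hZ.u₀_nonneg
  have hS := hX.sub hy2 hX'
  refine (hS.expBound hφ hy).mono hφ (mul_nonneg hy.nonneg ENNReal.toReal_nonneg) ?_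
  have := hS.eLpNorm_le hy2 (hZ.continuous_weight N a) (hZ.weight_nonneg N a)
    (div_nonneg zero_le_two (hZ.nonneg (by positivity)))
    (hZ.abs_kernelI_sub_le hκ N a hh ht hx) hfin
  calc _ ≤ C * (2 / Z (1 / h + u₀) * CZ (covFun μ y) Z u₀ N a) :=
        mul_le_mul_of_nonneg_left this hy.nonneg
    _ = _ := by
        rw [sigma]
        ring

end PhiSub

/-! ### Chaining with Hölder weights. -/

namespace PhiSub

variable {Ω : Type*} [MeasurableSpace Ω] {μ : Measure Ω} {φ : ℝ → ℝ}

theorem ExpBound.lintegral_sum_le {T : Type*} (hφ : IsNFunctionQ φ) {S : Finset T} {Y : T → Ω → ℝ}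
    {e c B : ℝ} (hY : ∀ q ∈ S, ExpBound φ μ (Y q) e) (hB : φ (e * c) ≤ B) :
    ∫⁻ ω, ∑ q ∈ S, (ENNReal.ofReal (Real.exp (c * Y q ω)) +
      ENNReal.ofReal (Real.exp (-c * Y q ω))) ∂μ ≤ ENNReal.ofReal (2 * S.card * Real.exp B) := by
  have hB' : φ (e * -c) ≤ B := by
    rw [mul_neg, hφ.even]
    exact hB
  have hm : ∀ q ∈ S, AEMeasurable (fun ω => ENNReal.ofReal (Real.exp (c * Y q ω)) +
      ENNReal.ofReal (Real.exp (-c * Y q ω))) μ := fun q hq =>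
    ((hY q hq).aemeasurable_exp c).add ((hY q hq).aemeasurable_exp (-c))
  rw [lintegral_finsetSum' _ hm]
  calc _ ≤ ∑ q ∈ S, ENNReal.ofReal (2 * Real.exp B) := by
        refine Finset.sum_le_sum fun q hq => ?_
        rw [lintegral_add_left' ((hY q hq).aemeasurable_exp c), two_mul,
          ENNReal.ofReal_add (Real.exp_pos _).le (Real.exp_pos _).le]
        refine add_le_add (((hY q hq).le c).trans ?_) (((hY q hq).le (-c)).trans ?_)
        · gcongr
        · gcongr
    _ = _ := by
        rw [Finset.sum_const, nsmul_eq_mul, mul_right_comm, mul_comm _ (S.card : ℝ),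
          ENNReal.ofReal_mul (Nat.cast_nonneg _), ENNReal.ofReal_natCast]

/-- Exponential tail bound for sums of increments chosen from finite layers. -/
theorem measure_layers_le [IsProbabilityMeasure μ] {T : Type*} (hφ : IsNFunctionQ φ) {s : Finset ℕ}
    {w e : ℕ → ℝ} (hw : ∀ k ∈ s, 0 < w k) (hw1 : ∑ k ∈ s, w k = 1) {S : ℕ → Finset T}
    {Y : ℕ → T → Ω → ℝ} (hY : ∀ k ∈ s, ∀ q ∈ S k, ExpBound φ μ (Y k q) (e k)) {l u B : ℝ}
    (hl : 0 ≤ l) (hB : ∀ k ∈ s, φ (e k * (l / w k)) ≤ B) :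
    μ {ω | ∃ j : ℕ → T, (∀ k ∈ s, j k ∈ S k) ∧ u < |∑ k ∈ s, Y k (j k) ω|} ≤
      ENNReal.ofReal (2 * Real.exp (B - l * u) * ∏ k ∈ s, ((S k).card : ℝ) ^ w k) := by
  set G : ℕ → Ω → ℝ≥0∞ := fun k ω => ∑ q ∈ S k, (ENNReal.ofReal (Real.exp (l / w k * Y k q ω)) +
      ENNReal.ofReal (Real.exp (-(l / w k) * Y k q ω))) with hG
  have hGm : ∀ k ∈ s, AEMeasurable (G k) μ := fun k hk =>
    Finset.aemeasurable_fun_sum _ fun q hq =>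
      ((hY k hk q hq).aemeasurable_exp _).add ((hY k hk q hq).aemeasurable_exp _)
  -- The sums `G k` dominate every `exp(l |Y k q| / w k)`, so their weighted product is a majorant
  -- independent of the selection `j`.
  have hsub : {ω | ∃ j : ℕ → T, (∀ k ∈ s, j k ∈ S k) ∧ u < |∑ k ∈ s, Y k (j k) ω|} ⊆
      {ω | ENNReal.ofReal (Real.exp (l * u)) ≤ ∏ k ∈ s, G k ω ^ w k} := by
    rintro ω ⟨j, hj, hu⟩
    have h1 : l * u ≤ ∑ k ∈ s, l * |Y k (j k) ω| := by
      rw [← Finset.mul_sum]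
      exact mul_le_mul_of_nonneg_left (hu.le.trans (Finset.abs_sum_le_sum_abs _ _)) hl
    calc ENNReal.ofReal (Real.exp (l * u)) ≤ ENNReal.ofReal (∏ k ∈ s, Real.exp (l * |Y k (j k) ω|)) := by
          rw [← Real.exp_sum]
          gcongr
      _ = ∏ k ∈ s, ENNReal.ofReal (Real.exp (l * |Y k (j k) ω|)) :=
          ENNReal.ofReal_prod_of_nonneg fun _ _ => (Real.exp_pos _).le
      _ ≤ _ := by
          refine Finset.prod_le_prod' fun k hk => ?_
          have hwk := hw k hk
          have e1 : Real.exp (l * |Y k (j k) ω|) = Real.exp (l / w k * |Y k (j k) ω|) ^ w k := by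
            rw [← Real.exp_mul]
            congr 1
            field_simp
          rw [e1, ← ENNReal.ofReal_rpow_of_pos (Real.exp_pos _)]
          refine ENNReal.rpow_le_rpow ?_ hwk.le
          refine le_trans ?_ (Finset.single_le_sum (f := fun q =>
            ENNReal.ofReal (Real.exp (l / w k * Y k q ω)) +
            ENNReal.ofReal (Real.exp (-(l / w k) * Y k q ω))) (fun _ _ => zero_le) (hj k hk))
          rcases abs_choice (Y k (j k) ω) with h | h <;> rw [h]
          · exact le_self_add
          · rw [mul_neg, ← neg_mul]
            exact le_add_self
  have hint : ∫⁻ ω, ∏ k ∈ s, G k ω ^ w k ∂μ ≤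
      ENNReal.ofReal (2 * Real.exp B * ∏ k ∈ s, ((S k).card : ℝ) ^ w k) := by
    -- Generalized Hölder with exponents `1 / w k`. Since the weights sum to `1`, the common factor
    -- `2 exp B` survives exactly once.
    refine (ENNReal.lintegral_prod_norm_pow_le s hGm hw1 fun k hk => (hw k hk).le).trans ?_
    calc ∏ k ∈ s, (∫⁻ ω, G k ω ∂μ) ^ w k
        ≤ ∏ k ∈ s, ENNReal.ofReal ((2 * Real.exp B) ^ w k * ((S k).card : ℝ) ^ w k) := by
          refine Finset.prod_le_prod' fun k hk => ?_
          rw [← Real.mul_rpow (by positivity) (by positivity),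
            ← ENNReal.ofReal_rpow_of_nonneg (by positivity) (hw k hk).le]
          refine ENNReal.rpow_le_rpow ?_ (hw k hk).le
          rw [mul_right_comm]
          exact ExpBound.lintegral_sum_le hφ (hY k hk) (hB k hk)
      _ = _ := by
          rw [← ENNReal.ofReal_prod_of_nonneg fun _ _ => by positivity, Finset.prod_mul_distrib,
            ← Real.rpow_sum_of_pos (by positivity), hw1, Real.rpow_one]
  have hexp : ENNReal.ofReal (Real.exp (l * u)) ≠ 0 := by simp [Real.exp_pos]
  have hmark := (measure_mono hsub).trans (meas_ge_le_lintegral_div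
    (Finset.aemeasurable_fun_prod s fun k hk => (hGm k hk).pow_const (w k)) hexp ENNReal.ofReal_ne_top)
  refine hmark.trans ((ENNReal.div_le_div_right hint _).trans (le_of_eq ?_))
  rw [← ENNReal.ofReal_div_of_pos (Real.exp_pos _), Real.exp_sub]
  congr 1
  ring

theorem sum_chain {T : Type*} (X : T → ℝ) (π : ℕ → T → T) (m : ℕ) (j : ℕ → T)
    (hj : ∀ k < m, j k = π k (j (k + 1))) :
    ∑ k ∈ Finset.range (m + 1), (if k = 0 then X (j k) else X (j k) - X (π (k - 1) (j k))) =
      X (j m) := by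
  induction m with
  | zero => simp
  | succ m ih =>
    rw [Finset.sum_range_succ, ih fun k hk => hj k (by omega)]
    simp [hj m (by omega)]

/-- The chain is built downwards from `p` at level `m`, so each link is determined by its upper end
alone and layer `k` needs only one increment per point. -/
theorem exists_chain {T : Type*} (π : ℕ → T → T) (m : ℕ) (p : T) :
    ∃ j : ℕ → T, j m = p ∧ ∀ k < m, j k = π k (j (k + 1)) := by
  induction m generalizing p with
  | zero => exact ⟨fun _ => p, rfl, by simp⟩
  | succ m ih =>
    obtain ⟨j, hj, hjk⟩ := ih (π m p)
    refine ⟨fun k => if k = m + 1 then p else j k, by simp, fun k hk => ?_⟩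
    rcases eq_or_lt_of_le (Nat.lt_succ_iff.1 hk) with rfl | hk'
    · simp [hj]
    · simp [hk.ne, hk'.ne, hjk k hk']

theorem sum_chain_weights (θ : ℝ) (m : ℕ) :
    ∑ k ∈ Finset.range m, (1 - θ) * θ ^ k + θ ^ m = 1 := by
  rw [← Finset.mul_sum, mul_neg_geom_sum]
  ring

/-- Tail bound for the maximum over a finite set, by chaining along finitely many nets. -/
theorem measure_finite_sup_le [IsProbabilityMeasure μ] {T : Type*} (hφ : IsNFunctionQ φ)
    {X : T → Ω → ℝ} {ε₀ θ : ℝ} (hε₀ : 0 ≤ ε₀) (hθ : 0 < θ) (hθ1 : θ < 1)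
    (hX : ∀ p, ExpBound φ μ (X p) ε₀) {V : ℕ → Finset T}
    (hV : ∀ k p, ∃ q ∈ V k, ExpBound φ μ (fun ω => X p ω - X q ω) (θ ^ (k + 1) * ε₀))
    (m : ℕ) (F : Finset T) {l u : ℝ} (hl : 0 ≤ l) :
    μ {ω | ∃ p ∈ F, u < |X p ω|} ≤ ENNReal.ofReal (2 * Real.exp (φ (l * ε₀ / (1 - θ)) - l * u) *
      ((∏ k ∈ Finset.range m, ((V k).card : ℝ) ^ ((1 - θ) * θ ^ k)) *
        (F.card : ℝ) ^ (θ ^ m))) := by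
  choose π hπV hπ using hV
  -- Levels below `m` are the nets; level `m` is `F` itself and takes the leftover weight `θ ^ m`.
  -- Level `0` carries `X` itself, and the shift `k - 1` makes links at level `k` have standard `θ ^
  -- k * ε₀`.
  have hθ' : 0 < 1 - θ := by linarith
  set w : ℕ → ℝ := fun k => if k < m then (1 - θ) * θ ^ k else θ ^ m with hw
  set S : ℕ → Finset T := fun k => if k < m then V k else F with hS
  set Y : ℕ → T → Ω → ℝ := fun k q ω =>
    if k = 0 then X q ω else X q ω - X (π (k - 1) q) ω with hYdef
  have hw0 : ∀ k ∈ Finset.range (m + 1), 0 < w k := fun k _ => by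
    simp only [hw]
    split_ifs <;> positivity
  have hw1 : ∑ k ∈ Finset.range (m + 1), w k = 1 := by
    rw [Finset.sum_range_succ, ← sum_chain_weights θ m]
    congr 1
    · exact Finset.sum_congr rfl fun k hk => if_pos (Finset.mem_range.1 hk)
    · simp [hw]
  have hY : ∀ k ∈ Finset.range (m + 1), ∀ q ∈ S k, ExpBound φ μ (Y k q) (θ ^ k * ε₀) := by
    intro k _ q _
    rcases k with _ | k
    · simpa [hYdef] using hX q
    · simpa [hYdef] using hπ k q
  have hB : ∀ k ∈ Finset.range (m + 1), φ (θ ^ k * ε₀ * (l / w k)) ≤ φ (l * ε₀ / (1 - θ)) := by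
    intro k hk
    refine hφ.mono_abs ?_
    have hwk := hw0 k hk
    have hle : (1 - θ) * θ ^ k ≤ w k := by
      simp only [hw]
      split_ifs with h
      · exact le_rfl
      · have : k = m := by
          have := Finset.mem_range.1 hk
          omega
        subst this
        have : 0 < θ ^ k := by positivity
        nlinarith
    rw [abs_of_nonneg (by positivity), abs_of_nonneg (by positivity), ← mul_div_assoc,
      div_le_div_iff₀ hwk hθ']
    calc θ ^ k * ε₀ * l * (1 - θ) = l * ε₀ * ((1 - θ) * θ ^ k) := by ring
      _ ≤ _ := by gcongr
  refine le_trans (measure_mono ?_) ((measure_layers_le (u := u) hφ hw0 hw1 hY hl hB).trans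
    (le_of_eq ?_))
  · rintro ω ⟨p, hp, hu⟩
    obtain ⟨j, hjm, hj⟩ := exists_chain π m p
    refine ⟨j, fun k hk => ?_, ?_⟩
    · simp only [hS]
      split_ifs with h
      · rw [hj k h]
        exact hπV _ _
      · have : k = m := by
          have := Finset.mem_range.1 hk
          omega
        rw [this, hjm]
        exact hp
    · have := sum_chain (fun q => X q ω) π m j hj
      simp only [hYdef]
      rw [this, hjm]
      exact hu
  · congr 2
    rw [Finset.prod_range_succ]
    congr 1
    · refine Finset.prod_congr rfl fun k hk => ?_
      simp [hw, hS, Finset.mem_range.1 hk]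
    · simp [hw, hS]

/-- Tail bound for the maximum over a finite set whose size does not enter the bound. -/
theorem measure_finite_sup_le_of_prod_le [IsProbabilityMeasure μ] {T : Type*} (hφ : IsNFunctionQ φ)
    {X : T → Ω → ℝ} {ε₀ θ : ℝ} (hε₀ : 0 ≤ ε₀) (hθ : 0 < θ) (hθ1 : θ < 1)
    (hX : ∀ p, ExpBound φ μ (X p) ε₀) {V : ℕ → Finset T}
    (hV : ∀ k p, ∃ q ∈ V k, ExpBound φ μ (fun ω => X p ω - X q ω) (θ ^ (k + 1) * ε₀))
    {R : ℝ} (hR : ∀ m, ∏ k ∈ Finset.range m, ((V k).card : ℝ) ^ ((1 - θ) * θ ^ k) ≤ R)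
    (F : Finset T) {l u : ℝ} (hl : 0 ≤ l) :
    μ {ω | ∃ p ∈ F, u < |X p ω|} ≤
      ENNReal.ofReal (2 * Real.exp (φ (l * ε₀ / (1 - θ)) - l * u) * R) := by
  rcases F.eq_empty_or_nonempty with rfl | hF
  · simp
  have hFc : (F.card : ℝ) ≠ 0 := by
    exact_mod_cast hF.card_ne_zero
  have hlim : Tendsto (fun m : ℕ => ENNReal.ofReal (2 * Real.exp (φ (l * ε₀ / (1 - θ)) - l * u) *
      (R * (F.card : ℝ) ^ (θ ^ m)))) atTop
      -- The weight of the last layer tends to zero, so the factor `card F ^ (θ ^ m)` tends to `1`.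
      (𝓝 (ENNReal.ofReal (2 * Real.exp (φ (l * ε₀ / (1 - θ)) - l * u) * R))) := by
    refine (ENNReal.continuous_ofReal.tendsto _).comp (Tendsto.const_mul _ ?_)
    have h1 : Tendsto (fun m : ℕ => (F.card : ℝ) ^ (θ ^ m)) atTop (𝓝 ((F.card : ℝ) ^ (0 : ℝ))) :=
      ((Real.continuous_const_rpow hFc).tendsto 0).comp
        (tendsto_pow_atTop_nhds_zero_of_lt_one hθ.le hθ1)
    rw [Real.rpow_zero] at h1
    simpa using h1.const_mul R
  refine ge_of_tendsto' hlim fun m =>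
    (measure_finite_sup_le hφ hε₀ hθ hθ1 hX hV m F hl).trans ?_
  gcongr
  exact hR m

end PhiSub

namespace PhiSub

/-! ### Inversion of `r` and comparison with the entropy integral. -/

section InverseR

variable {r : ℝ → ℝ}

/-- Continuity of `r` is not assumed. Convexity makes `r ∘ exp` continuous on the open half-line and
supplies its growth, so the intermediate value theorem applies away from `0`. -/
theorem exists_eq_of_convexOn_exp (hr_mono : StrictMonoOn r (Ici 1))
    (hr_convex : ConvexOn ℝ (Ici 0) (fun x => r (Real.exp x))) {D : ℝ} (hD : r 1 ≤ D) :
    ∃ x ∈ Ici (1 : ℝ), r x = D := by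
  rcases hD.eq_or_lt with rfl | hD
  · exact ⟨1, self_mem_Ici, rfl⟩
  set g : ℝ → ℝ := fun x => r (Real.exp x) with hg
  have hg0 : g 0 = r 1 := by simp [hg]
  have hg1 : g 0 < g 1 := by
    rw [hg0]
    exact hr_mono self_mem_Ici (mem_Ici.2 (Real.one_le_exp zero_le_one))
      (Real.one_lt_exp_iff.2 zero_lt_one)
  rw [← hg0] at hD
  have hslope : 0 < g 1 - g 0 := sub_pos.2 hg1
  -- The chord over `[0, 1]` rises by at most half of `D - g 0` up to `x₀`, and its extension is at
  -- or above `D` at `x₁`. Convexity puts `g` below the chord at `x₀` and above its extension at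
  -- `x₁`; clamping by `1` gives `x₀ ≤ 1 ≤ x₁`.
  set x₀ := min 1 ((D - g 0) / (2 * (g 1 - g 0))) with hx₀
  set x₁ := max 1 ((D - g 0) / (g 1 - g 0)) with hx₁
  have hx₀0 : 0 < x₀ := lt_min one_pos (div_pos (sub_pos.2 hD) (by positivity))
  have hx₁1 : 1 ≤ x₁ := le_max_left _ _
  have h0 : g x₀ < D := by
    have hle : x₀ * (g 1 - g 0) ≤ (D - g 0) / 2 := by
      have := min_le_right 1 ((D - g 0) / (2 * (g 1 - g 0)))
      rw [← hx₀, le_div_iff₀ (by positivity)] at this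
      linarith
    have := hr_convex.2 (mem_Ici.2 le_rfl) (mem_Ici.2 zero_le_one)
      (sub_nonneg.2 (min_le_left 1 ((D - g 0) / (2 * (g 1 - g 0))))) hx₀0.le (by ring)
    simp only [smul_eq_mul, mul_zero, zero_add, mul_one] at this
    change g x₀ ≤ (1 - x₀) * g 0 + x₀ * g 1 at this
    nlinarith
  have h1 : D ≤ g x₁ := by
    have hle : D - g 0 ≤ x₁ * (g 1 - g 0) := by
      have := le_max_right 1 ((D - g 0) / (g 1 - g 0))
      rwa [← hx₁, div_le_iff₀ hslope] at this
    have hx₁0 : 0 < x₁ := by linarith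
    have hinv : x₁⁻¹ ≤ 1 := inv_le_one_of_one_le₀ hx₁1
    have := hr_convex.2 (mem_Ici.2 le_rfl) (mem_Ici.2 hx₁0.le)
      (sub_nonneg.2 hinv) (inv_nonneg.2 hx₁0.le) (by ring)
    simp only [smul_eq_mul, mul_zero, zero_add, inv_mul_cancel₀ hx₁0.ne'] at this
    change g 1 ≤ (1 - x₁⁻¹) * g 0 + x₁⁻¹ * g x₁ at this
    have h2 : x₁ * g 1 ≤ x₁ * ((1 - x₁⁻¹) * g 0 + x₁⁻¹ * g x₁) :=
      mul_le_mul_of_nonneg_left this hx₁0.le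
    have h3 : x₁ * ((1 - x₁⁻¹) * g 0 + x₁⁻¹ * g x₁) = (x₁ - 1) * g 0 + g x₁ := by
      field_simp
    linarith
  have hcont : ContinuousOn g (Icc x₀ x₁) := by
    have := hr_convex.continuousOn_interior
    rw [interior_Ici] at this
    exact this.mono fun x hx => hx₀0.trans_le hx.1
  obtain ⟨x, hx, hxD⟩ := intermediate_value_Icc ((min_le_left _ _).trans hx₁1) hcont ⟨h0.le, h1⟩
  exact ⟨Real.exp x, mem_Ici.2 (Real.one_le_exp (hx₀0.le.trans hx.1)), hxD⟩

theorem invR_spec (hr_mono : StrictMonoOn r (Ici 1))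
    (hr_convex : ConvexOn ℝ (Ici 0) (fun x => r (Real.exp x))) {D : ℝ} (hD : r 1 ≤ D) :
    1 ≤ invR r D ∧ r (invR r D) = D :=
  ⟨Function.invFunOn_mem (exists_eq_of_convexOn_exp hr_mono hr_convex hD),
    Function.invFunOn_eq (exists_eq_of_convexOn_exp hr_mono hr_convex hD)⟩

/-- Each term is the length of `[θ^(k+1) E, θ^k E]` times the value of `g` at the right endpoint,
its minimum there. -/
theorem geom_sum_le_integral {g : ℝ → ℝ} {E θ : ℝ} (hE : 0 < E) (hθ : 0 < θ) (hθ1 : θ < 1)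
    (hg : AntitoneOn g (Ioc 0 E)) (hint : IntervalIntegrable g volume 0 E) (m : ℕ) :
    ∑ k ∈ Finset.range m, ((1 - θ) * θ ^ k) * g (θ ^ k * E) * E ≤ ∫ v in (θ ^ m * E)..E, g v := by
  have hpow (k : ℕ) : θ ^ k * E ∈ Ioc 0 E :=
    ⟨by positivity, mul_le_of_le_one_left hE.le (pow_le_one₀ hθ.le hθ1.le)⟩
  have hsub {x y : ℝ} (hx : x ∈ Icc 0 E) (hy : y ∈ Icc 0 E) : IntervalIntegrable g volume x y :=
    hint.mono_set (by rw [uIcc_of_le hE.le]; exact uIcc_subset_Icc hx hy)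
  induction m with
  | zero => simp
  | succ m ih =>
    rw [Finset.sum_range_succ, add_comm, ← intervalIntegral.integral_add_adjacent_intervals
      (hsub (Ioc_subset_Icc_self (hpow (m + 1))) (Ioc_subset_Icc_self (hpow m)))
      (hsub (Ioc_subset_Icc_self (hpow m)) (right_mem_Icc.2 hE.le))]
    refine add_le_add ?_ ih
    have hle : θ ^ (m + 1) * E ≤ θ ^ m * E := by
      have := (hpow m).1
      rw [pow_succ]
      nlinarith
    calc (1 - θ) * θ ^ m * g (θ ^ m * E) * E
        = ∫ _ in (θ ^ (m + 1) * E)..(θ ^ m * E), g (θ ^ m * E) := by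
          rw [intervalIntegral.integral_const, smul_eq_mul]
          ring
      _ ≤ _ := intervalIntegral.integral_mono_on hle intervalIntegrable_const
          (hsub (Ioc_subset_Icc_self (hpow (m + 1))) (Ioc_subset_Icc_self (hpow m)))
          fun x hx => hg ⟨(hpow (m + 1)).1.trans_le hx.1, hx.2.trans (hpow m).2⟩ (hpow m) hx.2

/-- A weighted geometric mean of covering numbers along a geometric sequence of scales is bounded
by the inverse of `r` at the normalized entropy integral. -/
theorem prod_rpow_le_invR (hr_mono : StrictMonoOn r (Ici 1))
    (hr_convex : ConvexOn ℝ (Ici 0) (fun x => r (Real.exp x))) {N : ℝ → ℝ} {E θ : ℝ} (hE : 0 < E)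
    (hθ : 0 < θ) (hθ1 : θ < 1) (hN1 : ∀ v ∈ Ioc 0 E, 1 ≤ N v) (hN : AntitoneOn N (Ioc 0 E))
    (hint : IntervalIntegrable (fun v => r (N v)) volume 0 E) :
    1 ≤ invR r ((∫ v in (0 : ℝ)..E, r (N v)) / E) ∧ ∀ m : ℕ,
      ∏ k ∈ Finset.range m, N (θ ^ k * E) ^ ((1 - θ) * θ ^ k) ≤
        invR r ((∫ v in (0 : ℝ)..E, r (N v)) / E) := by
  have hpow (k : ℕ) : θ ^ k * E ∈ Ioc 0 E :=
    ⟨by positivity, mul_le_of_le_one_left hE.le (pow_le_one₀ hθ.le hθ1.le)⟩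
  have hlow (m : ℕ) : θ ^ m * E * r 1 ≤ ∫ v in (0 : ℝ)..(θ ^ m * E), r (N v) := by
    calc θ ^ m * E * r 1 = ∫ _ in (0 : ℝ)..(θ ^ m * E), r 1 := by
          rw [intervalIntegral.integral_const, smul_eq_mul, sub_zero]
      _ ≤ _ := by
          refine intervalIntegral.integral_mono_on_of_le_Ioo (hpow m).1.le intervalIntegrable_const
            (hint.mono_set ?_) fun x hx => ?_
          · rw [uIcc_of_le hE.le, uIcc_of_le (hpow m).1.le]
            exact Icc_subset_Icc le_rfl (hpow m).2
          · exact hr_mono.monotoneOn self_mem_Ici (hN1 x ⟨hx.1, hx.2.le.trans (hpow m).2⟩)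
              (hN1 x ⟨hx.1, hx.2.le.trans (hpow m).2⟩)
  have hD : r 1 ≤ (∫ v in (0 : ℝ)..E, r (N v)) / E := by
    rw [le_div_iff₀ hE]
    have := hlow 0
    simp only [pow_zero, one_mul] at this
    linarith
  obtain ⟨h1, hrD⟩ := invR_spec hr_mono hr_convex hD
  refine ⟨h1, fun m => ?_⟩
  have hprod : ∏ k ∈ Finset.range m, N (θ ^ k * E) ^ ((1 - θ) * θ ^ k) =
      Real.exp (θ ^ m • (0 : ℝ) + ∑ k ∈ Finset.range m,
        ((1 - θ) * θ ^ k) • Real.log (N (θ ^ k * E))) := by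
    rw [smul_zero, zero_add, Real.exp_sum]
    refine Finset.prod_congr rfl fun k _ => ?_
    rw [Real.rpow_def_of_pos (zero_lt_one.trans_le (hN1 _ (hpow k))), smul_eq_mul, mul_comm]
  have hθ' : 0 < 1 - θ := sub_pos.2 hθ1
  have hlog (k : ℕ) : 0 ≤ Real.log (N (θ ^ k * E)) := Real.log_nonneg (hN1 _ (hpow k))
  -- The finite weights miss mass `θ ^ m`, which is placed at `log 1 = 0`. It costs `θ ^ m * r 1`,
  -- covered by the part of the integral over `[0, θ ^ m E]`.
  have hJ := hr_convex.map_add_sum_le (t := Finset.range m) (w := fun k => (1 - θ) * θ ^ k)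
    (p := fun k => Real.log (N (θ ^ k * E))) (v := θ ^ m) (q := 0) (fun k _ => by positivity)
    (by rw [add_comm]; exact sum_chain_weights θ m) (fun k _ => hlog k) (by positivity)
    (mem_Ici.2 le_rfl)
  rw [← hr_mono.le_iff_le _ (mem_Ici.2 h1), hrD, hprod]
  · refine hJ.trans ?_
    rw [le_div_iff₀ hE, add_mul, Finset.sum_mul]
    have hg : AntitoneOn (fun v => r (N v)) (Ioc 0 E) := fun x hx z hz hxz =>
      hr_mono.monotoneOn (hN1 z hz) (hN1 x hx) (hN hx hz hxz)
    have hup := geom_sum_le_integral hE hθ hθ1 hg hint m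
    have hsplit := intervalIntegral.integral_add_adjacent_intervals (a := 0) (b := θ ^ m * E)
      (c := E) (f := fun v => r (N v)) (μ := volume)
      (hint.mono_set (by
        rw [uIcc_of_le hE.le, uIcc_of_le (hpow m).1.le]
        exact Icc_subset_Icc le_rfl (hpow m).2))
      (hint.mono_set (by
        rw [uIcc_of_le hE.le, uIcc_of_le (hpow m).2]
        exact Icc_subset_Icc (hpow m).1.le le_rfl))
    rw [← hsplit]
    refine add_le_add ?_ (le_trans (le_of_eq ?_) hup)
    · refine le_trans (le_of_eq ?_) (hlow m)
      simp only [smul_eq_mul, Real.exp_zero]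
      ring
    · refine Finset.sum_congr rfl fun k _ => ?_
      rw [smul_eq_mul, Real.exp_log (zero_lt_one.trans_le (hN1 _ (hpow k)))]
  · rw [hprod]
    refine mem_Ici.2 (Real.one_le_exp ?_)
    rw [smul_zero, zero_add]
    exact Finset.sum_nonneg fun k _ => mul_nonneg (by positivity) (hlog k)

end InverseR

/-! ### Finite nets of intervals and rectangles. -/

section Net

theorem exists_net_Icc {a b h : ℝ} (hab : a ≤ b) (hh : 0 < h) : ∃ S : Finset ℝ,
    (∀ s ∈ S, s ∈ Icc a b) ∧ (S.card : ℝ) ≤ (b - a) / (2 * h) + 1 ∧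
      ∀ x ∈ Icc a b, ∃ s ∈ S, |x - s| ≤ h := by
  set n := ⌊(b - a) / (2 * h)⌋₊ + 1 with hn
  have hL : 0 ≤ (b - a) / (2 * h) := div_nonneg (sub_nonneg.2 hab) (by positivity)
  -- Midpoints of consecutive cells of length `2h`; the minimum with `b` keeps the last one inside
  -- the interval.
  refine ⟨(Finset.range n).image fun i : ℕ => min (a + (2 * i + 1) * h) b, ?_, ?_, ?_⟩
  · intro s hs
    obtain ⟨i, -, rfl⟩ := Finset.mem_image.1 hs
    exact ⟨le_min (le_add_of_nonneg_right (by positivity)) hab, min_le_right _ _⟩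
  · have : (((Finset.range n).image fun i : ℕ => min (a + (2 * i + 1) * h) b).card : ℝ) ≤ n := by
      exact_mod_cast Finset.card_image_le.trans_eq (Finset.card_range n)
    refine this.trans ?_
    rw [hn]
    push_cast
    gcongr
    exact Nat.floor_le hL
  · intro x hx
    have hx0 : 0 ≤ (x - a) / (2 * h) := div_nonneg (sub_nonneg.2 hx.1) (by positivity)
    have h1 := Nat.floor_le hx0
    have h2 := Nat.lt_floor_add_one ((x - a) / (2 * h))
    refine ⟨_, Finset.mem_image.2 ⟨⌊(x - a) / (2 * h)⌋₊, Finset.mem_range.2 ?_, rfl⟩, ?_⟩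
    · rw [hn, Nat.lt_succ_iff]
      refine Nat.floor_le_floor ?_
      gcongr
      exact hx.2
    · rw [le_div_iff₀ (by positivity)] at h1
      rw [div_lt_iff₀ (by positivity)] at h2
      rw [abs_le]
      constructor
      · have := min_le_left (a + (2 * (⌊(x - a) / (2 * h)⌋₊ : ℝ) + 1) * h) b
        linarith
      · have : x - h ≤ min (a + (2 * (⌊(x - a) / (2 * h)⌋₊ : ℝ) + 1) * h) b :=
          le_min (by linarith) (by linarith [hx.2])
        linarith

theorem exists_net_rect {a b c d h : ℝ} (hab : a ≤ b) (hcd : c ≤ d) (hh : 0 < h) :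
    ∃ V : Finset ↥(Icc a b ×ˢ Icc c d),
      (V.card : ℝ) ≤ ((b - a) / (2 * h) + 1) * ((d - c) / (2 * h) + 1) ∧
      ∀ p : ↥(Icc a b ×ˢ Icc c d), ∃ q ∈ V, |p.1.1 - q.1.1| ≤ h ∧ |p.1.2 - q.1.2| ≤ h := by
  classical
  obtain ⟨S, hS, hSc, hSn⟩ := exists_net_Icc hab hh
  obtain ⟨S', hS', hSc', hSn'⟩ := exists_net_Icc hcd hh
  refine ⟨(S ×ˢ S').subtype (· ∈ Icc a b ×ˢ Icc c d), ?_, fun p => ?_⟩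
  · have h1 : (((S ×ˢ S').subtype (· ∈ Icc a b ×ˢ Icc c d)).card : ℝ) ≤ S.card * S'.card := by
      rw [Finset.card_subtype]
      exact_mod_cast (Finset.card_filter_le _ _).trans_eq (Finset.card_product _ _)
    refine h1.trans (mul_le_mul hSc hSc' (Nat.cast_nonneg _) ((Nat.cast_nonneg _).trans hSc))
  · obtain ⟨s, hs, h1⟩ := hSn p.1.1 p.2.1
    obtain ⟨s', hs', h2⟩ := hSn' p.1.2 p.2.2
    exact ⟨⟨(s, s'), hS s hs, hS' s' hs'⟩, by simp [hs, hs'], h1, h2⟩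

end Net

/-! ### Inverses of `Z` and `σ`, and the covering bound. -/

section InverseZ

variable {φ Z : ℝ → ℝ} {u₀ C H v : ℝ}

theorem IsAdmissible.invZ_spec (hZ : IsAdmissible φ Z u₀) (hH : 0 < H) (hv : 0 < v)
    (hvγ : v ≤ 2 * C / Z (1 / H + u₀)) :
    1 / H + u₀ ≤ invZ Z (2 * C / v) ∧ Z (invZ Z (2 * C / v)) = 2 * C / v := by
  have hu := hZ.u₀_nonneg
  have h0 : 0 ≤ 1 / H + u₀ := by positivity
  have hpos : 0 < Z (1 / H + u₀) := hZ.pos _ (by positivity)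
  have hle : Z (1 / H + u₀) ≤ 2 * C / v := by
    rw [le_div_iff₀ hv]
    rw [le_div_iff₀ hpos] at hvγ
    linarith
  have hex : ∃ x ∈ Ici (0 : ℝ), Z x = 2 * C / v := by
    obtain ⟨B, hB, hB0⟩ := ((hZ.tendsto_top.eventually_ge_atTop (2 * C / v)).and
      (eventually_ge_atTop (1 / H + u₀))).exists
    obtain ⟨x, hx, hxv⟩ := intermediate_value_Icc hB0
      (hZ.continuousOn.mono fun x hx => mem_Ici.2 (h0.trans hx.1)) ⟨hle, hB⟩
    exact ⟨x, h0.trans hx.1, hxv⟩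
  have h1 : Z (invZ Z (2 * C / v)) = 2 * C / v := Function.invFunOn_eq hex
  have hmem : invZ Z (2 * C / v) ∈ Ici (0 : ℝ) := Function.invFunOn_mem hex
  refine ⟨?_, h1⟩
  rw [← hZ.strictMonoOn.le_iff_le (mem_Ici.2 h0) hmem]
  exact hle.trans h1.ge

theorem IsAdmissible.invZ_anti (hZ : IsAdmissible φ Z u₀) (hH : 0 < H) {v' : ℝ} (hv : 0 < v)
    (hvv : v ≤ v') (hvγ : v' ≤ 2 * C / Z (1 / H + u₀)) :
    invZ Z (2 * C / v') ≤ invZ Z (2 * C / v) := by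
  have hu := hZ.u₀_nonneg
  have h0 : 0 ≤ 1 / H + u₀ := by positivity
  have hpos : 0 < Z (1 / H + u₀) := hZ.pos _ (by positivity)
  obtain ⟨h1, h2⟩ := hZ.invZ_spec hH hv (hvv.trans hvγ)
  obtain ⟨h3, h4⟩ := hZ.invZ_spec hH (hv.trans_le hvv) hvγ
  rw [← hZ.strictMonoOn.le_iff_le (mem_Ici.2 (h0.trans h3)) (mem_Ici.2 (h0.trans h1)), h2, h4]
  have hC : 0 ≤ 2 * C := by
    rw [le_div_iff₀ hpos] at hvγ
    exact (mul_pos (hv.trans_le hvv) hpos).le.trans hvγ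
  gcongr

theorem IsAdmissible.sigma_inv (hZ : IsAdmissible φ Z u₀) (hH : 0 < H) (hv : 0 < v)
    (hvγ : v ≤ 2 * C / Z (1 / H + u₀)) :
    1 / (invZ Z (2 * C / v) - u₀) ∈ Ioc 0 H ∧
      sigma Z u₀ C (1 / (invZ Z (2 * C / v) - u₀)) = v := by
  have hu := hZ.u₀_nonneg
  have hpos : 0 < Z (1 / H + u₀) := hZ.pos _ (by positivity)
  obtain ⟨h1, h2⟩ := hZ.invZ_spec hH hv hvγ
  have hH' : 0 < 1 / H := by positivity
  have hd : 0 < invZ Z (2 * C / v) - u₀ := by linarith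
  have hC : 0 < 2 * C := by
    rw [le_div_iff₀ hpos] at hvγ
    exact (mul_pos hv hpos).trans_le hvγ
  refine ⟨⟨by positivity, ?_⟩, ?_⟩
  · rw [div_le_iff₀ hd]
    rw [div_add' _ _ _ hH.ne', div_le_iff₀ hH] at h1
    linarith
  · rw [sigma, one_div_one_div, sub_add_cancel, h2]
    exact div_div_cancel₀ hC.ne'

/-- `invFunOn` picks some preimage; injectivity of `σ`, from strict monotonicity of `Z` and `C ≠ 0`,
forces it to be the explicit one. -/
theorem IsAdmissible.invSigma_eq (hZ : IsAdmissible φ Z u₀) (hH : 0 < H) (hv : 0 < v)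
    (hvγ : v ≤ 2 * C / Z (1 / H + u₀)) :
    invSigma (sigma Z u₀ C) H v = 1 / (invZ Z (2 * C / v) - u₀) := by
  have hu := hZ.u₀_nonneg
  have hpos : 0 < Z (1 / H + u₀) := hZ.pos _ (by positivity)
  have hC : 2 * C ≠ 0 := by
    rw [le_div_iff₀ hpos] at hvγ
    exact ((mul_pos hv hpos).trans_le hvγ).ne'
  obtain ⟨hm, hs⟩ := hZ.sigma_inv hH hv hvγ
  have hex : ∃ x ∈ Ioc 0 H, sigma Z u₀ C x = v := ⟨_, hm, hs⟩
  have hm' : invSigma (sigma Z u₀ C) H v ∈ Ioc 0 H := Function.invFunOn_mem hex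
  have hs' : sigma Z u₀ C (invSigma (sigma Z u₀ C) H v) = v := Function.invFunOn_eq hex
  have hinj : InjOn (sigma Z u₀ C) (Ioc 0 H) := by
    intro x hx z hz hxz
    have hx1 : 0 < 1 / x + u₀ := add_pos_of_pos_of_nonneg (one_div_pos.2 hx.1) hu
    have hz1 : 0 < 1 / z + u₀ := add_pos_of_pos_of_nonneg (one_div_pos.2 hz.1) hu
    have hx' := hZ.pos _ hx1
    have hz' := hZ.pos _ hz1
    rw [sigma, sigma, div_eq_div_iff hx'.ne' hz'.ne'] at hxz
    have := hZ.strictMonoOn.injOn (mem_Ici.2 hx1.le) (mem_Ici.2 hz1.le)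
      (mul_left_cancel₀ hC hxz).symm
    simpa using this
  exact hinj hm' hm (hs'.trans hs.symm)

theorem IsAdmissible.entropyIntegrand_eq (hZ : IsAdmissible φ Z u₀) {r : ℝ → ℝ} {L₁ L₂ : ℝ}
    (hH : 0 < max L₁ L₂) (hv : 0 < v) (hvγ : v ≤ 2 * C / Z (1 / max L₁ L₂ + u₀)) :
    entropyIntegrand r (sigma Z u₀ C) L₁ L₂ v =
      r ((L₁ / 2 * (invZ Z (2 * C / v) - u₀) + 1) * (L₂ / 2 * (invZ Z (2 * C / v) - u₀) + 1)) := by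
  rw [entropyIntegrand, hZ.invSigma_eq hH hv hvγ]
  congr 3 <;> simp only [div_eq_mul_inv, mul_inv, inv_inv, mul_assoc, one_mul]

/-- The bound for the covering numbers of a rectangle with sides `L₁`, `L₂`. -/
noncomputable def coverBound (Z : ℝ → ℝ) (u₀ C L₁ L₂ v : ℝ) : ℝ :=
  if v ≤ 2 * C / Z (1 / max L₁ L₂ + u₀) then
    (L₁ / 2 * (invZ Z (2 * C / v) - u₀) + 1) * (L₂ / 2 * (invZ Z (2 * C / v) - u₀) + 1)
  else 1

variable {L₁ L₂ : ℝ}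

theorem IsAdmissible.invZ_sub_nonneg (hZ : IsAdmissible φ Z u₀) (hH : 0 < H) (hv : 0 < v)
    (hvγ : v ≤ 2 * C / Z (1 / H + u₀)) : 0 ≤ invZ Z (2 * C / v) - u₀ := by
  have h := (hZ.invZ_spec hH hv hvγ).1
  have : 0 < 1 / H := by positivity
  linarith

theorem one_le_coverBound (hZ : IsAdmissible φ Z u₀) (h1 : 0 ≤ L₁) (h2 : 0 ≤ L₂)
    (hH : 0 < max L₁ L₂) (hv : 0 < v) : 1 ≤ coverBound Z u₀ C L₁ L₂ v := by
  unfold coverBound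
  split_ifs with h
  · have := hZ.invZ_sub_nonneg hH hv h
    exact one_le_mul_of_one_le_of_one_le (le_add_of_nonneg_left (by positivity))
      (le_add_of_nonneg_left (by positivity))
  · exact le_rfl

theorem antitoneOn_coverBound (hZ : IsAdmissible φ Z u₀) (h1 : 0 ≤ L₁) (h2 : 0 ≤ L₂)
    (hH : 0 < max L₁ L₂) : AntitoneOn (coverBound Z u₀ C L₁ L₂) (Ioi 0) := by
  intro v hv v' hv' hvv
  by_cases h : v' ≤ 2 * C / Z (1 / max L₁ L₂ + u₀)
  · rw [coverBound, coverBound, if_pos h, if_pos (hvv.trans h)]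
    have h3 := hZ.invZ_anti hH hv hvv h
    have h4 := hZ.invZ_sub_nonneg hH hv' h
    gcongr
    exact add_nonneg (by have := h4.trans (sub_le_sub_right h3 u₀); positivity) zero_le_one
  · have : coverBound Z u₀ C L₁ L₂ v' = 1 := if_neg h
    rw [this]
    exact one_le_coverBound hZ h1 h2 hH hv

/-- The scale `γ` separates genuine nets, which give `hatI`, from one-point nets, which give the
constant `r 1`. -/
theorem coverBound_integral (hZ : IsAdmissible φ Z u₀) {r : ℝ → ℝ} {γ E : ℝ}
    (hH : 0 < max L₁ L₂) (hC : 0 ≤ C) (hγ : γ = 2 * C / Z (1 / max L₁ L₂ + u₀))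
    (hent : ∀ ε, 0 < ε → ε ≤ γ → IntegrableOn (entropyIntegrand r (sigma Z u₀ C) L₁ L₂) (Ioc 0 ε))
    (hE : 0 < E) :
    IntervalIntegrable (fun v => r (coverBound Z u₀ C L₁ L₂ v)) volume 0 E ∧
      ∫ v in (0 : ℝ)..E, r (coverBound Z u₀ C L₁ L₂ v) =
        hatI r Z u₀ C L₁ L₂ (min E γ) + r 1 * max (E - γ) 0 := by
  have hu := hZ.u₀_nonneg
  have hγ0 : 0 ≤ γ := hγ ▸ div_nonneg (by positivity) (hZ.nonneg (by positivity))
  have hm0 : 0 ≤ min E γ := le_min hE.le hγ0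
  have hlow : EqOn (fun v => r (coverBound Z u₀ C L₁ L₂ v)) (fun s =>
      r ((L₁ / 2 * (invZ Z (2 * C / s) - u₀) + 1) * (L₂ / 2 * (invZ Z (2 * C / s) - u₀) + 1)))
      (Ioc 0 (min E γ)) := fun v hv => by
    have : v ≤ 2 * C / Z (1 / max L₁ L₂ + u₀) := hγ ▸ hv.2.trans (min_le_right _ _)
    simp only [coverBound, if_pos this]
  have hhigh : EqOn (fun v => r (coverBound Z u₀ C L₁ L₂ v)) (fun _ => r 1)
      (Ioc (min E γ) E) := fun v hv => by
    have : ¬ v ≤ 2 * C / Z (1 / max L₁ L₂ + u₀) := by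
      rw [← hγ, not_le]
      rcases min_choice E γ with h | h
      · rw [h] at hv
        exact absurd hv.2 (not_le.2 hv.1)
      · rw [h] at hv
        exact hv.1
    simp only [coverBound, if_neg this]
  have hI1 : IntervalIntegrable (fun v => r (coverBound Z u₀ C L₁ L₂ v)) volume 0 (min E γ) := by
    rw [intervalIntegrable_iff_integrableOn_Ioc_of_le hm0]
    rcases hm0.eq_or_lt with h | h
    -- If `γ = 0` the lower interval is empty and the entropy condition is not needed.
    · simp [← h]
    · refine (hent _ h (min_le_right _ _)).congr_fun (fun v hv => ?_) measurableSet_Ioc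
      refine Eq.trans ?_ (hlow hv).symm
      exact hZ.entropyIntegrand_eq hH hv.1 (hγ ▸ hv.2.trans (min_le_right _ _))
  have hI2 : IntervalIntegrable (fun v => r (coverBound Z u₀ C L₁ L₂ v)) volume (min E γ) E := by
    rw [intervalIntegrable_iff_integrableOn_Ioc_of_le (min_le_left _ _)]
    exact (integrableOn_const (by simp)).congr_fun hhigh.symm measurableSet_Ioc
  refine ⟨hI1.trans hI2, ?_⟩
  rw [← intervalIntegral.integral_add_adjacent_intervals hI1 hI2, hatI]
  congr 1
  · rw [intervalIntegral.integral_of_le hm0, intervalIntegral.integral_of_le hm0]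
    exact setIntegral_congr_fun measurableSet_Ioc hlow
  · rw [intervalIntegral.integral_of_le (min_le_left _ _),
      setIntegral_congr_fun measurableSet_Ioc hhigh, ← intervalIntegral.integral_of_le
      (min_le_left _ _), intervalIntegral.integral_const, smul_eq_mul, mul_comm]
    congr 1
    rcases le_total E γ with h | h
    · simp [h]
    · simp [h]

end InverseZ

end PhiSub

/-! ### From finite maxima to the supremum of the field. -/

namespace PhiSub

variable {Ω : Type*} [MeasurableSpace Ω] {μ : Measure Ω} {φ : ℝ → ℝ}

/-- Bounds for maxima over finite sets pass to the supremum of a sample continuous field. -/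
theorem measure_iSup_le {a b c d : ℝ} (hab : a ≤ b) (hcd : c ≤ d) {U : ℝ → ℝ → Ω → ℝ}
    (hUcont : ∀ᵐ ω ∂μ, ContinuousOn (fun p : ℝ × ℝ => U p.1 p.2 ω) (Icc a b ×ˢ Icc c d))
    {u : ℝ} (hu : 0 < u) {B : ℝ≥0∞}
    (hB : ∀ F : Finset ↥(Icc a b ×ˢ Icc c d), μ {ω | ∃ p ∈ F, u < |U p.1.1 p.1.2 ω|} ≤ B) :
    μ {ω | ENNReal.ofReal u < ⨆ t ∈ Icc a b, ⨆ x ∈ Icc c d, ENNReal.ofReal |U t x ω|} ≤ B := by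
  classical
  have : Nonempty ↥(Icc a b ×ˢ Icc c d) := ⟨⟨(a, c), left_mem_Icc.2 hab, left_mem_Icc.2 hcd⟩⟩
  let D := TopologicalSpace.denseSeq ↥(Icc a b ×ˢ Icc c d)
  let A : ℕ → Set Ω := fun n => {ω | ∃ p ∈ (Finset.range n).image D, u < |U p.1.1 p.1.2 ω|}
  have hA : Monotone A := by
    rintro m n hmn ω ⟨p, hp, h⟩
    exact ⟨p, Finset.image_subset_image (Finset.range_mono hmn) hp, h⟩
  have hsub : {ω | ENNReal.ofReal u < ⨆ t ∈ Icc a b, ⨆ x ∈ Icc c d, ENNReal.ofReal |U t x ω|}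
      ≤ᵐ[μ] ⋃ n, A n := by
    filter_upwards [hUcont] with ω hω h
    have h : ENNReal.ofReal u < ⨆ t ∈ Icc a b, ⨆ x ∈ Icc c d, ENNReal.ofReal |U t x ω| := h
    simp only [lt_iSup_iff] at h
    obtain ⟨t, ht, x, hx, h⟩ := h
    have hpos := (ENNReal.ofReal_lt_ofReal_iff_of_nonneg hu.le).1 h
    have hc := continuousOn_iff_continuous_domRestrict.1 hω
    -- By continuity the exceedance set is open, so it contains a point of the dense sequence.
    obtain ⟨n, hn⟩ := (TopologicalSpace.denseRange_denseSeq
      ↥(Icc a b ×ˢ Icc c d)).exists_mem_open (isOpen_lt continuous_const hc.abs)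
      ⟨⟨(t, x), ht, hx⟩, hpos⟩
    exact mem_iUnion.2 ⟨n + 1, D n, Finset.mem_image_of_mem _ (Finset.self_mem_range_succ n), hn⟩
  refine (measure_mono_ae hsub).trans ?_
  rw [hA.measure_iUnion]
  exact iSup_le fun n => hB _

/-- Optimization over the exponential parameter produces the Young--Fenchel transform. -/
theorem le_exp_neg_conj (hφ : IsNFunctionQ φ) {m R x : ℝ} (hm : 0 ≤ m) (hR : 0 < R) (hx : 0 ≤ x)
    (h : ∀ y : ℝ, 0 ≤ y → m ≤ 2 * Real.exp (φ y - x * y) * R) :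
    m ≤ 2 * (Real.exp (-conj φ x) * R) := by
  rcases hm.eq_or_lt with rfl | hm
  · positivity
  -- For `m > 0` the hypothesis says `x y - φ y ≤ log (2R/m)` when `y ≥ 0`; replacing `y` by `|y|`
  -- covers the rest, so the supremum is bounded directly.
  have hc : conj φ x ≤ Real.log (2 * R / m) := by
    refine ciSup_le fun y => ?_
    have h1 := h |y| (abs_nonneg y)
    have h2 : φ |y| ≤ φ y := hφ.mono_abs (abs_abs y).le
    have h3 : x * y ≤ x * |y| := mul_le_mul_of_nonneg_left (le_abs_self y) hx
    rw [Real.le_log_iff_exp_le (by positivity), le_div_iff₀ hm]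
    calc Real.exp (x * y - φ y) * m ≤
          Real.exp (x * |y| - φ |y|) * (2 * Real.exp (φ |y| - x * |y|) * R) := by gcongr
      _ = 2 * R * Real.exp (x * |y| - φ |y| + (φ |y| - x * |y|)) := by
          rw [Real.exp_add]
          ring
      _ = 2 * R := by simp
  have h4 : Real.exp (-Real.log (2 * R / m)) ≤ Real.exp (-conj φ x) := by gcongr
  rw [Real.exp_neg, Real.exp_log (by positivity), inv_div, div_le_iff₀ (by positivity)] at h4
  linarith

/-- With zero standard all exponential moments are at most `1`; a single layer gives `2 exp(-l u)
card F`, and `l → ∞`. -/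
theorem measure_finite_sup_eq_zero [IsProbabilityMeasure μ] (hφ : IsNFunctionQ φ) {T : Type*}
    {X : T → Ω → ℝ} (hX : ∀ p, ExpBound φ μ (X p) 0) (F : Finset T) {u : ℝ} (hu : 0 < u) :
    μ {ω | ∃ p ∈ F, u < |X p ω|} ≤ 0 := by
  have hbound (l : ℕ) : μ {ω | ∃ p ∈ F, u < |X p ω|} ≤
      ENNReal.ofReal (2 * Real.exp (-(l * u)) * F.card) := by
    have := measure_layers_le hφ (s := {0}) (w := fun _ => 1) (e := fun _ => 0) (S := fun _ => F)
      (Y := fun _ => X) (B := 0) (l := l) (u := u) (by simp) (by simp) (fun k _ q _ => hX q)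
      (Nat.cast_nonneg l) (by simp [hφ.zero])
    refine le_trans (measure_mono ?_) (this.trans (le_of_eq ?_))
    · rintro ω ⟨p, hp, h⟩
      exact ⟨fun _ => p, fun _ _ => hp, by simpa using h⟩
    · simp
  have h1 : Tendsto (fun l : ℕ => 2 * Real.exp (-(l * u)) * (F.card : ℝ)) atTop (𝓝 0) := by
    have h2 : Tendsto (fun l : ℕ => Real.exp (-(l * u))) atTop (𝓝 0) :=
      Real.tendsto_exp_neg_atTop_nhds_zero.comp (tendsto_natCast_atTop_atTop.atTop_mul_const hu)
    simpa using (h2.const_mul 2).mul_const (F.card : ℝ)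
  have h3 := (ENNReal.continuous_ofReal.tendsto 0).comp h1
  rw [ENNReal.ofReal_zero] at h3
  exact ge_of_tendsto' h3 hbound

section Field

variable {Z : ℝ → ℝ} {u₀ : ℝ} {y : ℝ → Ω → ℝ} {Cy : ℝ} {κ : ℝ → ℝ} {N : ℕ} {α : ℕ → ℝ}
  {a b c d : ℝ} {U : ℝ → ℝ → Ω → ℝ}

theorem expBound_field_increment [IsProbabilityMeasure μ] (hφ : IsNFunctionQ φ)
    (hZ : IsAdmissible φ Z u₀) (hy : IsStrictlyPhiSubGaussian φ μ y Cy)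
    (hκ : κ = Real.cos ∨ κ = Real.sin) (hCZ : CZsq (covFun μ y) Z u₀ N α < ∞)
    (hrect : 0 < max (b - a) (d - c))
    (hU : ∀ t ∈ Icc a b, ∀ x ∈ Icc c d, IsMSIntegral μ (kernelI κ N α t x) y (U t x))
    (p q : ↥(Icc a b ×ˢ Icc c d)) :
    ExpBound φ μ (fun ω => U p.1.1 p.1.2 ω - U q.1.1 q.1.2 ω)
      (sigma Z u₀ (Cy * CZ (covFun μ y) Z u₀ N α) (max (b - a) (d - c))) := by
  obtain ⟨⟨t, x⟩, ht, hx⟩ := p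
  obtain ⟨⟨t', x'⟩, ht', hx'⟩ := q
  refine expBound_increment hφ hZ hy hκ hCZ hrect ?_ ?_ (hU t ht x hx) (hU t' ht' x' hx')
  · refine le_trans ?_ (le_max_left _ _)
    rw [abs_le]
    constructor <;> linarith [ht.1, ht.2, ht'.1, ht'.2]
  · refine le_trans ?_ (le_max_right _ _)
    rw [abs_le]
    constructor <;> linarith [hx.1, hx.2, hx'.1, hx'.2]

/-- One corner value plus an increment over the whole rectangle gives a uniform constant. It makes
the supremum defining `ε₀` finite and each `tau` meaningful. -/
theorem exists_expBound_field [IsProbabilityMeasure μ] (hφ : IsNFunctionQ φ)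
    (hZ : IsAdmissible φ Z u₀) (hy : IsStrictlyPhiSubGaussian φ μ y Cy)
    (hκ : κ = Real.cos ∨ κ = Real.sin) (hCZ : CZsq (covFun μ y) Z u₀ N α < ∞)
    (hab : a ≤ b) (hcd : c ≤ d) (hrect : 0 < max (b - a) (d - c))
    (hU : ∀ t ∈ Icc a b, ∀ x ∈ Icc c d, IsMSIntegral μ (kernelI κ N α t x) y (U t x)) :
    ∃ M : ℝ, 0 < M ∧ ∀ p : ↥(Icc a b ×ˢ Icc c d), ExpBound φ μ (U p.1.1 p.1.2) M := by
  have hu := hZ.u₀_nonneg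
  let p₀ : ↥(Icc a b ×ˢ Icc c d) := ⟨(a, c), left_mem_Icc.2 hab, left_mem_Icc.2 hcd⟩
  have h₀ := (hU a (left_mem_Icc.2 hab) c (left_mem_Icc.2 hcd)).expBound hφ hy
  set K := Cy * (eLpNorm (U a c) 2 μ).toReal with hK
  have hK0 : 0 ≤ K := mul_nonneg hy.nonneg ENNReal.toReal_nonneg
  set s := sigma Z u₀ (Cy * CZ (covFun μ y) Z u₀ N α) (max (b - a) (d - c)) with hs
  have hs0 : 0 ≤ s := div_nonneg (mul_nonneg zero_le_two
    (mul_nonneg hy.nonneg (Real.sqrt_nonneg _))) (hZ.nonneg (by positivity))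
  refine ⟨(s + 1) + (K + 1), by positivity, fun p => ?_⟩
  have h1 := (expBound_field_increment hφ hZ hy hκ hCZ hrect hU p p₀).mono hφ hs0
    (le_add_of_nonneg_right zero_le_one)
  have h2 := h1.add (h₀.mono hφ hK0 (le_add_of_nonneg_right zero_le_one)) (by positivity)
    (by positivity)
  exact h2.congr (ae_of_all _ fun ω => sub_add_cancel _ _)

/-- At every scale `v` the rectangle has a net for the sub-Gaussian metric of the field whose size
is controlled by `coverBound`. -/
theorem exists_net_field [IsProbabilityMeasure μ] (hφ : IsNFunctionQ φ)
    (hZ : IsAdmissible φ Z u₀) (hy : IsStrictlyPhiSubGaussian φ μ y Cy)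
    (hκ : κ = Real.cos ∨ κ = Real.sin) (hCZ : CZsq (covFun μ y) Z u₀ N α < ∞)
    (hab : a ≤ b) (hcd : c ≤ d) (hrect : 0 < max (b - a) (d - c))
    (hU : ∀ t ∈ Icc a b, ∀ x ∈ Icc c d, IsMSIntegral μ (kernelI κ N α t x) y (U t x))
    {v : ℝ} (hv : 0 < v) :
    ∃ V : Finset ↥(Icc a b ×ˢ Icc c d),
      (V.card : ℝ) ≤
        coverBound Z u₀ (Cy * CZ (covFun μ y) Z u₀ N α) (b - a) (d - c) v ∧
      ∀ p : ↥(Icc a b ×ˢ Icc c d), ∃ q ∈ V,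
        ExpBound φ μ (fun ω => U p.1.1 p.1.2 ω - U q.1.1 q.1.2 ω) v := by
  have hu := hZ.u₀_nonneg
  by_cases h : v ≤ 2 * (Cy * CZ (covFun μ y) Z u₀ N α) / Z (1 / max (b - a) (d - c) + u₀)
  · obtain ⟨hm, hs⟩ := hZ.sigma_inv hrect hv h
    obtain ⟨V, hVc, hV⟩ := exists_net_rect hab hcd hm.1
    refine ⟨V, hVc.trans (le_of_eq ?_), fun p => ?_⟩
    · rw [coverBound, if_pos h]
      congr 2 <;> simp only [div_eq_mul_inv, mul_inv, inv_inv, mul_assoc, one_mul]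
    · obtain ⟨q, hq, h1, h2⟩ := hV p
      refine ⟨q, hq, ?_⟩
      have := expBound_increment hφ hZ hy hκ hCZ hm.1 h1 h2 (hU _ p.2.1 _ p.2.2)
        (hU _ q.2.1 _ q.2.2)
      rwa [hs] at this
  · refine ⟨{⟨(a, c), left_mem_Icc.2 hab, left_mem_Icc.2 hcd⟩}, ?_, fun p => ?_⟩
    · rw [coverBound, if_neg h]
      simp
    · refine ⟨_, Finset.mem_singleton_self _,
        (expBound_field_increment hφ hZ hy hκ hCZ hrect hU p _).mono hφ ?_ (not_le.1 h).le⟩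
      exact div_nonneg (mul_nonneg zero_le_two
        (mul_nonneg hy.nonneg (Real.sqrt_nonneg _))) (hZ.nonneg (by positivity))

end Field

end PhiSub

theorem theorem3 {Ω : Type*} [MeasurableSpace Ω] (μ : Measure Ω) [IsProbabilityMeasure μ]
    -- the `N`-function and the admissible function
    (φ : ℝ → ℝ) (hφ : PhiSub.IsNFunctionQ φ)
    (Z : ℝ → ℝ) (u₀ : ℝ) (hZ : PhiSub.IsAdmissible φ Z u₀)
    -- the process `y`
    (y : ℝ → Ω → ℝ) (Cy : ℝ) (hy : PhiSub.IsStrictlyPhiSubGaussian φ μ y Cy)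
    (hvar : PhiSub.HasFiniteVitaliVariation (PhiSub.covFun μ y))
    -- the field `U` on the rectangle `[a, b] × [c, d]`
    (κ : ℝ → ℝ) (hκ : κ = Real.cos ∨ κ = Real.sin) (N : ℕ) (α : ℕ → ℝ)
    (a b c d : ℝ) (hab : a ≤ b) (hcd : c ≤ d) (hrect : 0 < max (b - a) (d - c))
    (U : ℝ → ℝ → Ω → ℝ)
    (hU : ∀ t ∈ Icc a b, ∀ x ∈ Icc c d,
      PhiSub.IsMSIntegral μ (PhiSub.kernelI κ N α t x) y (U t x))
    (hUcont : ∀ᵐ ω ∂μ, ContinuousOn (fun p : ℝ × ℝ => U p.1 p.2 ω) (Icc a b ×ˢ Icc c d))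
    -- convergence of the integral `C_Z ^ 2`, and the constants `C_Z`, `γ₀`, `ε₀`
    (hCZ : PhiSub.CZsq (PhiSub.covFun μ y) Z u₀ N α < ∞)
    (CZ : ℝ) (hCZ_def : CZ = PhiSub.CZ (PhiSub.covFun μ y) Z u₀ N α)
    (γ₀ : ℝ) (hγ₀ : γ₀ = 2 * Cy * CZ / Z (1 / max (b - a) (d - c) + u₀))
    (ε₀ : ℝ) (hε₀ : ε₀ = PhiSub.eps0 φ μ U a b c d)
    -- the function `r` and the entropy condition
    (r : ℝ → ℝ) (hr_nonneg : ∀ x, 1 ≤ x → 0 ≤ r x) (hr_mono : StrictMonoOn r (Ici 1))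
    (hr_convex : ConvexOn ℝ (Ici 0) (fun x => r (Real.exp x)))
    (hentropy : ∀ ε, 0 < ε → ε ≤ γ₀ →
      IntegrableOn (PhiSub.entropyIntegrand r (PhiSub.sigma Z u₀ (Cy * CZ)) (b - a) (d - c))
        (Ioc 0 ε)) :
    ∀ θ u : ℝ, 0 < θ → θ < 1 → 0 < u →
      μ {ω | ENNReal.ofReal u < ⨆ t ∈ Icc a b, ⨆ x ∈ Icc c d, ENNReal.ofReal |U t x ω|} ≤
        ENNReal.ofReal (2 * (Real.exp (-PhiSub.conj φ (u * (1 - θ) / ε₀)) *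
          PhiSub.invR r
            ((PhiSub.hatI r Z u₀ (Cy * CZ) (b - a) (d - c) (min (θ * ε₀) γ₀)
                + r 1 * max (θ * ε₀ - γ₀) 0) / (θ * ε₀)))) := by
  intro θ u hθ hθ1 hu
  subst hCZ_def
  set C := Cy * PhiSub.CZ (PhiSub.covFun μ y) Z u₀ N α with hC
  have hC0 : 0 ≤ C := mul_nonneg hy.nonneg (Real.sqrt_nonneg _)
  have hγ : γ₀ = 2 * C / Z (1 / max (b - a) (d - c) + u₀) := by rw [hγ₀, hC, mul_assoc]
  have hba : 0 ≤ b - a := sub_nonneg.2 hab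
  have hdc : 0 ≤ d - c := sub_nonneg.2 hcd
  obtain ⟨M, hM, hUM⟩ := PhiSub.exists_expBound_field hφ hZ hy hκ hCZ hab hcd hrect hU
  have hbdd : BddAbove ((fun p : ℝ × ℝ => PhiSub.tau φ μ (U p.1 p.2)) '' (Icc a b ×ˢ Icc c d)) := by
    refine ⟨M, ?_⟩
    rintro _ ⟨p, hp, rfl⟩
    exact (hUM ⟨p, hp⟩).tau_le hφ hM.le
  have htau : ∀ p : ↥(Icc a b ×ˢ Icc c d), PhiSub.tau φ μ (U p.1.1 p.1.2) ≤ ε₀ := fun p => by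
    rw [hε₀]
    exact le_csSup hbdd ⟨p.1, p.2, rfl⟩
  have hX : ∀ p : ↥(Icc a b ×ˢ Icc c d), PhiSub.ExpBound φ μ (U p.1.1 p.1.2) ε₀ := fun p =>
    ((hUM p).tau hφ hM).mono hφ (PhiSub.tau_nonneg _) (htau p)
  have hε₀0 : 0 ≤ ε₀ := (PhiSub.tau_nonneg _).trans
    (htau ⟨(a, c), left_mem_Icc.2 hab, left_mem_Icc.2 hcd⟩)
  refine PhiSub.measure_iSup_le hab hcd hUcont hu fun F => ?_
  -- For `ε₀ = 0` the right-hand side involves division by zero, but the probability vanishes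
  -- anyway.
  rcases hε₀0.eq_or_lt with h0 | hpos
  · rw [← h0] at hX
    exact (PhiSub.measure_finite_sup_eq_zero hφ hX F hu).trans zero_le
  have hE : 0 < θ * ε₀ := mul_pos hθ hpos
  obtain ⟨hint, hval⟩ := PhiSub.coverBound_integral (r := r) (E := θ * ε₀) hZ hrect hC0 hγ
    hentropy hE
  obtain ⟨hR1, hR⟩ := PhiSub.prod_rpow_le_invR hr_mono hr_convex hE hθ hθ1
    (fun v hv => PhiSub.one_le_coverBound hZ hba hdc hrect hv.1)
    ((PhiSub.antitoneOn_coverBound hZ hba hdc hrect).mono fun v hv => hv.1) hint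
  rw [hval] at hR1 hR
  have hnet (k : ℕ) := PhiSub.exists_net_field hφ hZ hy hκ hCZ hab hcd hrect hU
    (v := θ ^ k * (θ * ε₀)) (by positivity)
  choose V hVc hV using hnet
  set R := PhiSub.invR r ((PhiSub.hatI r Z u₀ C (b - a) (d - c) (min (θ * ε₀) γ₀)
                + r 1 * max (θ * ε₀ - γ₀) 0) / (θ * ε₀)) with hRdef
  have hθ' : 0 < 1 - θ := sub_pos.2 hθ1
  have hprod (m : ℕ) :
      ∏ k ∈ Finset.range m, ((V k).card : ℝ) ^ ((1 - θ) * θ ^ k) ≤ R := by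
    refine le_trans (Finset.prod_le_prod (fun k _ => by positivity) fun k _ => ?_) (hR m)
    exact Real.rpow_le_rpow (Nat.cast_nonneg _) (hVc k) (by positivity)
  have hV' : ∀ k (p : ↥(Icc a b ×ˢ Icc c d)), ∃ q ∈ V k, PhiSub.ExpBound φ μ
      (fun ω => U p.1.1 p.1.2 ω - U q.1.1 q.1.2 ω) (θ ^ (k + 1) * ε₀) := fun k p => by
    rw [pow_succ, mul_assoc]
    exact hV k p
  have htail (l : ℝ) (hl : 0 ≤ l) := PhiSub.measure_finite_sup_le_of_prod_le
    (X := fun p : ↥(Icc a b ×ˢ Icc c d) => U p.1.1 p.1.2) hφ hpos.le hθ hθ1 hX hV' hprod F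
    (u := u) hl
  have hR0 : 0 < R := zero_lt_one.trans_le hR1
  rw [← ENNReal.ofReal_toReal (measure_ne_top μ {ω | ∃ p ∈ F, u < |U p.1.1 p.1.2 ω|})]
  refine ENNReal.ofReal_le_ofReal (PhiSub.le_exp_neg_conj hφ ENNReal.toReal_nonneg hR0
    (by positivity) fun z hz => ?_)
  -- This exponential parameter makes the argument of `φ` equal to `z`, so optimizing over `z` gives
  -- the conjugate at `u (1 - θ) / ε₀`.
  have := htail (z * (1 - θ) / ε₀) (by positivity)
  have e1 : z * (1 - θ) / ε₀ * ε₀ / (1 - θ) = z := by field_simp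
  have e2 : z * (1 - θ) / ε₀ * u = u * (1 - θ) / ε₀ * z := by ring
  rw [e1, e2] at this
  exact ENNReal.toReal_le_of_le_ofReal (by positivity) this
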